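/- Let $\Gamma$ be a finite metrized graph: a finite graph (multiple edges and self-loops allowed) in which every edge $e$ is identified with a segment $[0,L_e]$, $L_e>0$, whose ends are glued to vertices. On a connected such graph let $j_z(x,y)$ be the voltage function, i.e. the voltage difference between $x$ and $z$ when unit current enters at $y$ and exits at $z$ and each edge has resistance equal to its length. Equivalently, $x\mapsto j_z(x,y)$ is the unique continuous piecewise affine function with $j_z(z,y)=0$ and $\Delta_x j_z(x,y)=\delta_y-\delta_z$, where $\Delta f=-\sum_p\big(\sum_{\vec v\text{ at }p}d_{\vec v}f(p)\big)\delta_p$. Put $r(x,y)=j_x(y,y)$ and $$A_{p,q,\Gamma}=\int_\Gamma j_x(p,q)\Big(\frac{d}{dx}j_p(x,q)\Big)^2dx .$$ The tau constant is $\tau(\Gamma)=\tfrac12 j_\mu(x,x)$, where $j_\mu(x,y)=\int_\Gamma j_\zeta(x,y)\,d\mu(\zeta)$ and $\mu$ is the canonical measure, the signed Borel measure of total mass $1$ on $\Gamma$ for which $j_\mu(x,x)$ is constant in $x\in\Gamma$. Let $e_i$ be an edge of $\Gamma$ with length $L_i$ and end points $p_i,q_i$, and let $\Gamma-e_i$ be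 obtained from $\Gamma$ by removing the interior of $e_i$. Suppose $\Gamma-e_i$ is connected, and let $R_i$ be the resistance between $p_i$ and $q_i$ in $\Gamma-e_i$. Then $$\tau(\Gamma)=\tau(\Gamma-e_i)+\frac{L_i}{12}-\frac{R_i}{6}+\frac{A_{p_i,q_i,\Gamma-e_i}}{L_i+R_i}.$$ -/

import Mathlib

open MeasureTheory Set Filter Topology

noncomputable section

/-- Combinatorial data of a metrized graph with vertex set `V` and edge set `E`: every edge `e` is
a segment parametrized by `[0, length e]`, whose initial end `0` is the vertex `src e` and whose
final end `length e` is the vertex `tgt e`. Multiple edges and self-loops are allowed.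
Connectedness is the separate predicate `MetrizedGraph.Connected`. -/
structure MetrizedGraph (V E : Type*) where
  src : E → V
  tgt : E → V
  length : E → ℝ
  length_pos : ∀ e, 0 < length e

namespace MetrizedGraph

variable {V E : Type*}

/-- The graph is connected: it is non-empty and any two vertices are joined by a chain of edges
(each traversed in either direction). -/
def Connected (Γ : MetrizedGraph V E) : Prop :=
  Nonempty V ∧ ∀ u v : V, Relation.EqvGen (fun a b => ∃ e, Γ.src e = a ∧ Γ.tgt e = b) u v

/-- `Γ - e₀`: the interior of the edge `e₀` is removed; all vertices are kept. -/
def deleteEdge (Γ : MetrizedGraph V E) (e₀ : E) : MetrizedGraph V {e : E // e ≠ e₀} where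
  src e := Γ.src e
  tgt e := Γ.tgt e
  length e := Γ.length e
  length_pos e := Γ.length_pos e

/-- The points of the metrized graph: the vertices, and the interior points of the edges. -/
inductive Point (Γ : MetrizedGraph V E) : Type _
  | vertex (v : V) : Point Γ
  | inner (e : E) (t : ℝ) (h0 : 0 < t) (h1 : t < Γ.length e) : Point Γ

/-- The point at parameter `t` of the edge `e`, where `t` is clamped to `[0, length e]`. -/
def pt (Γ : MetrizedGraph V E) (e : E) (t : ℝ) : Γ.Point :=
  if h0 : 0 < t then
    if h1 : t < Γ.length e then .inner e t h0 h1 else .vertex (Γ.tgt e)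
  else .vertex (Γ.src e)

/-- The topology of the metrized graph: the segments glued at their ends, that is, a set is open
if and only if its preimage under the parametrization of every edge is open. -/
instance (Γ : MetrizedGraph V E) : TopologicalSpace Γ.Point :=
  ⨆ e : E, TopologicalSpace.coinduced (Γ.pt e) inferInstance

instance (Γ : MetrizedGraph V E) : MeasurableSpace Γ.Point := borel Γ.Point

instance (Γ : MetrizedGraph V E) : BorelSpace Γ.Point := ⟨rfl⟩

/-- `f` is continuous on the graph and, on each edge, affine near every interior parameter outside
some finite set. -/
def IsPiecewiseAffine (Γ : MetrizedGraph V E) (f : Γ.Point → ℝ) : Prop :=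
  Continuous f ∧ ∀ e : E, ∃ T : Set ℝ, T.Finite ∧ ∀ t ∈ Ioo 0 (Γ.length e) \ T,
    ∃ m : ℝ, ∀ᶠ s in 𝓝 t, f (Γ.pt e s) = f (Γ.pt e t) + m * (s - t)

/-- The right derivative of `f` along the edge `e` at the parameter `t`: the directional
derivative in the direction of increasing parameter. -/
def rightSlope (Γ : MetrizedGraph V E) (f : Γ.Point → ℝ) (e : E) (t : ℝ) : ℝ :=
  derivWithin (fun s => f (Γ.pt e s)) (Ici t) t

/-- The left derivative of `f` along the edge `e` at the parameter `t`: its negative is the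
directional derivative in the direction of decreasing parameter. -/
def leftSlope (Γ : MetrizedGraph V E) (f : Γ.Point → ℝ) (e : E) (t : ℝ) : ℝ :=
  derivWithin (fun s => f (Γ.pt e s)) (Iic t) t

open Classical in
/-- The mass at `p` of the Laplacian of a continuous piecewise affine function `f`:
`Δ f = ∑ p, (laplacian f p) δ_p`, where `laplacian f p` is minus the sum of the directional
derivatives of `f` in all the directions emanating from `p` (a self-loop at a vertex contributes
two directions). -/
def laplacian (Γ : MetrizedGraph V E) [Fintype E] (f : Γ.Point → ℝ) : Γ.Point → ℝ
  | .vertex v => -∑ e : E, ((if Γ.src e = v then Γ.rightSlope f e 0 else 0) +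
      (if Γ.tgt e = v then -Γ.leftSlope f e (Γ.length e) else 0))
  | .inner e t _ _ => -(Γ.rightSlope f e t - Γ.leftSlope f e t)

open Classical in
/-- `f` is the potential when unit current enters at `y` and exits at `z`, with reference
voltage `0` at `z`, each edge having resistance equal to its length:
`Δ f = δ_y - δ_z` and `f z = 0`. -/
def IsVoltage (Γ : MetrizedGraph V E) [Fintype E] (z y : Γ.Point) (f : Γ.Point → ℝ) : Prop :=
  Γ.IsPiecewiseAffine f ∧ f z = 0 ∧
    ∀ p, Γ.laplacian f p = (if p = y then 1 else 0) - (if p = z then 1 else 0)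

/-- The voltage function `j_z(x, y)`: the value at `x` of the unique potential for unit current
entering at `y` and exiting at `z`. -/
def voltage (Γ : MetrizedGraph V E) [Fintype E] (z x y : Γ.Point) : ℝ :=
  Classical.epsilon (Γ.IsVoltage z y) x

/-- The resistance function `r(x, y) = j_x(y, y)`. -/
def resistance (Γ : MetrizedGraph V E) [Fintype E] (x y : Γ.Point) : ℝ :=
  Γ.voltage x y y

/-- `j_μ(x, y) = ∫ j_ζ(x, y) dμ(ζ)` for a finite signed Borel measure `μ` on the graph. -/
def voltageIntegral (Γ : MetrizedGraph V E) [Fintype E] (μ : SignedMeasure Γ.Point)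
    (x y : Γ.Point) : ℝ :=
  ∫ᵛ ζ, Γ.voltage ζ x y ∂<•μ

/-- `μ` is a canonical measure: a signed Borel measure of total mass `1` for which `j_μ(x, x)` is
constant on the graph. -/
def IsCanonicalMeasure (Γ : MetrizedGraph V E) [Fintype E] (μ : SignedMeasure Γ.Point) : Prop :=
  μ univ = 1 ∧ ∀ x y : Γ.Point, Γ.voltageIntegral μ x x = Γ.voltageIntegral μ y y

/-- The tau constant: the constant `j_μ(x, x) / 2`, where `μ` is the canonical measure. -/
def tau (Γ : MetrizedGraph V E) [Fintype E] : ℝ :=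
  Classical.epsilon fun t : ℝ => ∃ μ : SignedMeasure Γ.Point,
    Γ.IsCanonicalMeasure μ ∧ ∀ x : Γ.Point, t = (1 / 2) * Γ.voltageIntegral μ x x

/-- `A_{p,q,Γ} = ∫_Γ j_x(p, q) (d/dx j_p(x, q))² dx`. -/
def integralA (Γ : MetrizedGraph V E) [Fintype E] (p q : Γ.Point) : ℝ :=
  ∑ e : E, ∫ t in (0 : ℝ)..Γ.length e,
    Γ.voltage (Γ.pt e t) p q * deriv (fun s => Γ.voltage p (Γ.pt e s) q) t ^ 2

end MetrizedGraph

end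

/-! Everything reduces to the Green function `g` of the finite vertex set, grounded at a vertex `o`:
`g v` represents the functional h ↦ h(v) - h(o) for the Dirichlet form E. Double linear
interpolation plus the Green function of each edge with grounded ends extends `g` to all points, and
uniqueness of potentials gives j_z(x,y) = g(x,y) - g(x,z) - g(z,y) + g(z,z) (`IsGreen.voltage_eq`).

Write D(v) = g(v,v) and w_e = 1/L_e - r_e/L_e², with r_e the resistance between the ends of e. An
explicit measure with density w_e on each edge and suitable vertex masses satisfies ∫ g(x,y) dμ(x) =
g(y,y)/2, so it is canonical, and integrating r against it gives τ = E(D,D)/4 + (1/12) ∑ w_e² L_e³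
(`IsGreen.tau_eq`).

Now let `g` be the Green function of Γ - e_i grounded at p, and put h = g(q,·), R = h(q), s = L + R.
Restoring the edge is a rank one perturbation of E, so the Green function of Γ is g - h⊗h/s
(`IsGreen.of_deleteEdge`). Substituting in the formula for τ and expanding edge by edge produces τ(Γ
- e_i), A/s, and multiples of E(h,h²), E(h,hD), E(h,h³). Since h is itself a Green potential, these
equal R², R², R³. With the share of the restored edge, the rest adds up to L/12 - R/6. -/

/-! ### Locally affine functions of one real variable -/

/-- A continuous function that is locally affine inside an interval is affine on the interval. -/
theorem exists_slope_of_locally_affine {φ : ℝ → ℝ} {a b : ℝ} (hab : a < b) (hφ : Continuous φ)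
    (hloc : ∀ t ∈ Ioo a b, ∃ m : ℝ, ∀ᶠ s in 𝓝 t, φ s = φ t + m * (s - t)) :
    ∃ m : ℝ, ∀ s ∈ Icc a b, φ s = φ a + m * (s - a) := by
  have haff : ∀ c m t s : ℝ, HasDerivAt (fun s => c + m * (s - t)) m s := fun c m t s => by
    simpa using (((hasDerivAt_id s).sub_const t).const_mul m).const_add c
  have hderiv : ∀ t ∈ Ioo a b, ∃ m : ℝ, ∀ᶠ s in 𝓝 t, HasDerivAt φ m s := by
    intro t ht
    obtain ⟨m, hm⟩ := hloc t ht
    refine ⟨m, ?_⟩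
    filter_upwards [hm.eventually_nhds] with s hs
    exact (haff (φ t) m t s).congr_of_eventuallyEq hs
  -- φ' is locally constant, hence has derivative 0, hence is constant on the connected interval;
  -- continuity then carries the affine formula to the end points.
  have hconst : ∀ t ∈ Ioo a b, HasDerivAt (deriv φ) 0 t := by
    intro t ht
    obtain ⟨m, hm⟩ := hderiv t ht
    exact (hasDerivAt_const t m).congr_of_eventuallyEq (hm.mono fun s hs => hs.deriv)
  obtain ⟨c, hc⟩ := nonempty_Ioo.2 hab
  set m := deriv φ c with hm
  have hd : ∀ t ∈ Ioo a b, HasDerivAt φ m t := by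
    intro t ht
    have h1 : deriv φ t = deriv φ c :=
      isOpen_Ioo.is_const_of_deriv_eq_zero isPreconnected_Ioo
        (fun x hx => (hconst x hx).differentiableAt.differentiableWithinAt)
        (fun x hx => (hconst x hx).deriv) ht hc
    obtain ⟨m', hm'⟩ := hderiv t ht
    have h2 := hm'.self_of_nhds
    rw [hm, ← h1, h2.deriv]
    exact h2
  have hd' : ∀ t ∈ Ioo a b, HasDerivAt (fun s => φ s - m * (s - a)) 0 t := by
    intro t ht
    have := (hd t ht).fun_sub (haff 0 m a t)
    simpa using this
  have hin : EqOn (fun s => φ s - m * (s - a)) (fun _ => φ c - m * (c - a)) (Ioo a b) :=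
    fun t ht => isOpen_Ioo.is_const_of_deriv_eq_zero isPreconnected_Ioo
        (fun x hx => (hd' x hx).differentiableAt.differentiableWithinAt)
        (fun x hx => (hd' x hx).deriv) ht hc
  have hcl : EqOn (fun s => φ s - m * (s - a)) (fun _ => φ c - m * (c - a)) (Icc a b) := by
    have := hin.closure (by fun_prop) continuous_const
    rwa [closure_Ioo hab.ne] at this
  refine ⟨m, fun s hs => ?_⟩
  have h1 := hcl hs
  have h2 := hcl (left_mem_Icc.2 hab.le)
  simp only at h1 h2
  linarith

/-- The exceptional set is finite, so a short interval to the right of t avoids it, even when t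
itself is exceptional. -/
theorem exists_right_slope {φ : ℝ → ℝ} {a b : ℝ} (hφ : Continuous φ) {T : Set ℝ} (hT : T.Finite)
    (hloc : ∀ t ∈ Ioo a b \ T, ∃ m : ℝ, ∀ᶠ s in 𝓝 t, φ s = φ t + m * (s - t))
    {t : ℝ} (ht : t ∈ Ico a b) :
    ∃ m : ℝ, ∀ᶠ s in 𝓝[≥] t, φ s = φ t + m * (s - t) := by
  have h1 : ∀ᶠ s in 𝓝[≥] t, s ∉ T \ {t} :=
    nhdsWithin_le_nhds ((hT.subset sdiff_subset).isClosed.isOpen_compl.mem_nhds (by simp))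
  have h2 : ∀ᶠ s in 𝓝[≥] t, s < b := nhdsWithin_le_nhds (Iio_mem_nhds ht.2)
  obtain ⟨u, hu, hsub⟩ := mem_nhdsGE_iff_exists_Ico_subset.1 (h1.and h2)
  obtain ⟨m, hm⟩ := exists_slope_of_locally_affine hu hφ fun s hs => hloc s
    ⟨⟨ht.1.trans_lt hs.1, (hsub ⟨hs.1.le, hs.2⟩).2⟩, fun hsT =>
      (hsub ⟨hs.1.le, hs.2⟩).1 ⟨hsT, hs.1.ne'⟩⟩
  exact ⟨m, mem_of_superset (Icc_mem_nhdsGE hu) hm⟩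

theorem exists_left_slope {φ : ℝ → ℝ} {a b : ℝ} (hφ : Continuous φ) {T : Set ℝ} (hT : T.Finite)
    (hloc : ∀ t ∈ Ioo a b \ T, ∃ m : ℝ, ∀ᶠ s in 𝓝 t, φ s = φ t + m * (s - t))
    {t : ℝ} (ht : t ∈ Ioc a b) :
    ∃ m : ℝ, ∀ᶠ s in 𝓝[≤] t, φ s = φ t + m * (s - t) := by
  have h1 : ∀ᶠ s in 𝓝[≤] t, s ∉ T \ {t} :=
    nhdsWithin_le_nhds ((hT.subset sdiff_subset).isClosed.isOpen_compl.mem_nhds (by simp))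
  have h2 : ∀ᶠ s in 𝓝[≤] t, a < s := nhdsWithin_le_nhds (Ioi_mem_nhds ht.1)
  obtain ⟨u, hu, hsub⟩ := mem_nhdsLE_iff_exists_Ioc_subset.1 (h1.and h2)
  obtain ⟨m, hm⟩ := exists_slope_of_locally_affine hu hφ fun s hs => hloc s
    ⟨⟨(hsub ⟨hs.1, hs.2.le⟩).2, hs.2.trans_le ht.2⟩, fun hsT =>
      (hsub ⟨hs.1, hs.2.le⟩).1 ⟨hsT, hs.2.ne⟩⟩
  refine ⟨m, mem_of_superset (Icc_mem_nhdsLE hu) fun s hs => ?_⟩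
  change φ s = φ t + m * (s - t)
  rw [hm s hs, hm t (right_mem_Icc.2 (le_of_lt hu))]
  ring

theorem hasDerivWithinAt_of_eventually_affine {φ : ℝ → ℝ} {s : Set ℝ} {t m : ℝ}
    (h : ∀ᶠ u in 𝓝[s] t, φ u = φ t + m * (u - t)) : HasDerivWithinAt φ m s t := by
  have : HasDerivAt (fun u => φ t + m * (u - t)) m t := by
    simpa using (((hasDerivAt_id t).sub_const t).const_mul m).const_add (φ t)
  exact this.hasDerivWithinAt.congr_of_eventuallyEq h (by simp)

/-! ### Parametrization of the edges, one-sided slopes, linearity of the Laplacian -/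

namespace MetrizedGraph

variable {V E : Type*} {Γ : MetrizedGraph V E}

theorem continuous_pt (e : E) : Continuous (Γ.pt e) :=
  continuous_iff_coinduced_le.2 (le_iSup (fun e => TopologicalSpace.coinduced (Γ.pt e) inferInstance) e)

theorem continuous_iff_forall_pt {X : Type*} [TopologicalSpace X] {f : Γ.Point → X} :
    Continuous f ↔ ∀ e, Continuous fun t => f (Γ.pt e t) := by
  refine ⟨fun h e => h.comp (continuous_pt e), fun h => ?_⟩
  exact continuous_iSup_dom.2 fun e => continuous_coinduced_dom.2 (h e)

theorem pt_of_nonpos {e : E} {t : ℝ} (h : t ≤ 0) : Γ.pt e t = .vertex (Γ.src e) := by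
  simp [pt, not_lt.2 h]

theorem pt_zero (e : E) : Γ.pt e 0 = .vertex (Γ.src e) := pt_of_nonpos le_rfl

theorem pt_of_length_le {e : E} {t : ℝ} (h : Γ.length e ≤ t) : Γ.pt e t = .vertex (Γ.tgt e) := by
  simp [pt, not_lt.2 h, (Γ.length_pos e).trans_le h]

theorem pt_length (e : E) : Γ.pt e (Γ.length e) = .vertex (Γ.tgt e) := pt_of_length_le le_rfl

theorem pt_of_mem_Ioo {e : E} {t : ℝ} (h0 : 0 < t) (h1 : t < Γ.length e) :
    Γ.pt e t = .inner e t h0 h1 := by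
  simp [pt, h0, h1]

variable (Γ) in
/-- The parameter `t` clamped to the segment `[0, length e]`. -/
noncomputable def clamp (e : E) (t : ℝ) : ℝ := max 0 (min t (Γ.length e))

@[fun_prop]
theorem continuous_clamp (e : E) : Continuous (Γ.clamp e) := by
  unfold clamp; fun_prop

theorem clamp_of_mem {e : E} {t : ℝ} (h : t ∈ Icc 0 (Γ.length e)) : Γ.clamp e t = t := by
  simp [clamp, h.1, h.2]

theorem clamp_mem (e : E) (t : ℝ) : Γ.clamp e t ∈ Icc 0 (Γ.length e) := by
  simp [clamp, (Γ.length_pos e).le]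

/-- Formulas written in `clamp` hold for every real parameter, which is what continuity on the graph
demands: the topology is coinduced from all of ℝ. -/
theorem pt_clamp (e : E) (t : ℝ) : Γ.pt e (Γ.clamp e t) = Γ.pt e t := by
  rcases le_total t 0 with h | h
  · rw [pt_of_nonpos h, clamp, max_eq_left ((min_le_left _ _).trans h), pt_zero]
  · rcases le_total t (Γ.length e) with h' | h'
    · rw [clamp_of_mem ⟨h, h'⟩]
    · rw [pt_of_length_le h', clamp, min_eq_right h', max_eq_right (Γ.length_pos e).le, pt_length]

namespace IsPiecewiseAffine

variable {f h : Γ.Point → ℝ}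

theorem exists_right (hf : Γ.IsPiecewiseAffine f) {e : E} {t : ℝ} (ht : t ∈ Ico 0 (Γ.length e)) :
    ∀ᶠ s in 𝓝[≥] t, f (Γ.pt e s) = f (Γ.pt e t) + Γ.rightSlope f e t * (s - t) := by
  obtain ⟨T, hT, hloc⟩ := hf.2 e
  obtain ⟨m, hm⟩ := exists_right_slope (hf.1.comp (continuous_pt e)) hT hloc ht
  have : Γ.rightSlope f e t = m :=
    (hasDerivWithinAt_of_eventually_affine hm).derivWithin
      (uniqueDiffOn_Ici t t (mem_Ici.2 le_rfl))
  rw [this]; exact hm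

theorem exists_left (hf : Γ.IsPiecewiseAffine f) {e : E} {t : ℝ} (ht : t ∈ Ioc 0 (Γ.length e)) :
    ∀ᶠ s in 𝓝[≤] t, f (Γ.pt e s) = f (Γ.pt e t) + Γ.leftSlope f e t * (s - t) := by
  obtain ⟨T, hT, hloc⟩ := hf.2 e
  obtain ⟨m, hm⟩ := exists_left_slope (hf.1.comp (continuous_pt e)) hT hloc ht
  have : Γ.leftSlope f e t = m :=
    (hasDerivWithinAt_of_eventually_affine hm).derivWithin
      (uniqueDiffOn_Iic t t (mem_Iic.2 le_rfl))
  rw [this]; exact hm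

end IsPiecewiseAffine

theorem rightSlope_eq {f : Γ.Point → ℝ} {e : E} {t m : ℝ}
    (h : ∀ᶠ s in 𝓝[≥] t, f (Γ.pt e s) = f (Γ.pt e t) + m * (s - t)) : Γ.rightSlope f e t = m :=
  (hasDerivWithinAt_of_eventually_affine (φ := fun s => f (Γ.pt e s)) h).derivWithin
      (uniqueDiffOn_Ici t t (mem_Ici.2 le_rfl))

theorem leftSlope_eq {f : Γ.Point → ℝ} {e : E} {t m : ℝ}
    (h : ∀ᶠ s in 𝓝[≤] t, f (Γ.pt e s) = f (Γ.pt e t) + m * (s - t)) : Γ.leftSlope f e t = m :=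
  (hasDerivWithinAt_of_eventually_affine (φ := fun s => f (Γ.pt e s)) h).derivWithin
      (uniqueDiffOn_Iic t t (mem_Iic.2 le_rfl))

theorem IsPiecewiseAffine.linearCombination {f h : Γ.Point → ℝ} (hf : Γ.IsPiecewiseAffine f)
    (hh : Γ.IsPiecewiseAffine h) (a b : ℝ) : Γ.IsPiecewiseAffine fun p => a * f p + b * h p := by
  refine ⟨by have := hf.1; have := hh.1; fun_prop, fun e => ?_⟩
  obtain ⟨T, hT, hloc⟩ := hf.2 e
  obtain ⟨T', hT', hloc'⟩ := hh.2 e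
  refine ⟨T ∪ T', hT.union hT', fun t ht => ?_⟩
  obtain ⟨m, hm⟩ := hloc t ⟨ht.1, fun h => ht.2 (.inl h)⟩
  obtain ⟨m', hm'⟩ := hloc' t ⟨ht.1, fun h => ht.2 (.inr h)⟩
  refine ⟨a * m + b * m', ?_⟩
  filter_upwards [hm, hm'] with s h1 h2
  rw [h1, h2]; ring

theorem rightSlope_linearCombination {f h : Γ.Point → ℝ} (hf : Γ.IsPiecewiseAffine f)
    (hh : Γ.IsPiecewiseAffine h) (a b : ℝ) {e : E} {t : ℝ} (ht : t ∈ Ico 0 (Γ.length e)) :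
    Γ.rightSlope (fun p => a * f p + b * h p) e t =
      a * Γ.rightSlope f e t + b * Γ.rightSlope h e t := by
  apply rightSlope_eq
  filter_upwards [hf.exists_right ht, hh.exists_right ht] with s h1 h2
  rw [h1, h2]; ring

theorem leftSlope_linearCombination {f h : Γ.Point → ℝ} (hf : Γ.IsPiecewiseAffine f)
    (hh : Γ.IsPiecewiseAffine h) (a b : ℝ) {e : E} {t : ℝ} (ht : t ∈ Ioc 0 (Γ.length e)) :
    Γ.leftSlope (fun p => a * f p + b * h p) e t =
      a * Γ.leftSlope f e t + b * Γ.leftSlope h e t := by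
  apply leftSlope_eq
  filter_upwards [hf.exists_left ht, hh.exists_left ht] with s h1 h2
  rw [h1, h2]; ring

theorem laplacian_linearCombination [Fintype E] {f h : Γ.Point → ℝ} (hf : Γ.IsPiecewiseAffine f)
    (hh : Γ.IsPiecewiseAffine h) (a b : ℝ) (p : Γ.Point) :
    Γ.laplacian (fun p => a * f p + b * h p) p = a * Γ.laplacian f p + b * Γ.laplacian h p := by
  cases p with
  | vertex v =>
    simp only [laplacian, mul_neg, Finset.mul_sum, ← neg_add, ← Finset.sum_add_distrib]
    congr 1
    refine Finset.sum_congr rfl fun e _ => ?_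
    rw [rightSlope_linearCombination hf hh a b ⟨le_rfl, Γ.length_pos e⟩,
      leftSlope_linearCombination hf hh a b ⟨Γ.length_pos e, le_rfl⟩]
    split_ifs <;> ring
  | inner e t h0 h1 =>
    simp only [laplacian]
    rw [rightSlope_linearCombination hf hh a b ⟨h0.le, h1⟩,
      leftSlope_linearCombination hf hh a b ⟨h0, h1.le⟩]
    ring

end MetrizedGraph

/-! ### Green functions on vertices and on points, and the voltage function -/

namespace MetrizedGraph

variable {V E : Type*} {Γ : MetrizedGraph V E}

variable (Γ) in
/-- The Dirichlet form on functions of the vertices. -/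
noncomputable def energy [Fintype E] (f h : V → ℝ) : ℝ :=
  ∑ e, (f (Γ.src e) - f (Γ.tgt e)) * (h (Γ.src e) - h (Γ.tgt e)) / Γ.length e

variable (Γ) in
/-- `g` is the Green function of the vertices with reference vertex `o`: `g v` is the potential
of a unit current from `v` to `o`. -/
structure IsGreen [Fintype E] (o : V) (g : V → V → ℝ) : Prop where
  apply_base : ∀ v, g v o = 0
  energy_eq : ∀ v h, Γ.energy (g v) h = h v - h o

theorem energy_comm [Fintype E] (f h : V → ℝ) : Γ.energy f h = Γ.energy h f :=
  Finset.sum_congr rfl fun e _ => by ring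

/-- Reciprocity: evaluate the energy of `g u` against `g v` in both ways. -/
theorem IsGreen.symm [Fintype E] {o : V} {g : V → V → ℝ} (hg : Γ.IsGreen o g) (u v : V) :
    g u v = g v u := by
  have h1 := hg.energy_eq u (g v)
  have h2 := hg.energy_eq v (g u)
  rw [energy_comm, h2, hg.apply_base, hg.apply_base] at h1
  linarith

theorem IsGreen.base_apply [Fintype E] {o : V} {g : V → V → ℝ} (hg : Γ.IsGreen o g) (v : V) :
    g o v = 0 := by rw [hg.symm, hg.apply_base]

theorem energy_sum_right [Fintype E] [Fintype V] [DecidableEq V] (f h : V → ℝ) :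
    Γ.energy f h = ∑ v, h v * Γ.energy f (Pi.single v 1) := by
  simp only [energy, Finset.mul_sum]
  rw [Finset.sum_comm]
  refine Finset.sum_congr rfl fun e _ => ?_
  have : ∀ w, ∑ v, h v * (Pi.single v 1 : V → ℝ) w = h w := fun w => by
    simp [Pi.single_apply]
  rw [← this (Γ.src e), ← this (Γ.tgt e), ← Finset.sum_sub_distrib, Finset.mul_sum,
    Finset.sum_div]
  refine Finset.sum_congr rfl fun v _ => ?_
  ring

/-- The function on the graph that is affine on every edge, with prescribed vertex values. -/
noncomputable def interp (f : V → ℝ) : Γ.Point → ℝ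
  | .vertex v => f v
  | .inner e t _ _ => f (Γ.src e) + (f (Γ.tgt e) - f (Γ.src e)) * (t / Γ.length e)

open Classical in
/-- The Green function of the disjoint union of the edges with grounded ends. -/
noncomputable def edgeGreen : Γ.Point → Γ.Point → ℝ
  | .inner e t _ _, .inner e' s _ _ => if e = e' then min t s - t * s / Γ.length e else 0
  | _, _ => 0

/-- The extension to all points of a Green function of the vertices. -/
noncomputable def green (g : V → V → ℝ) (x y : Γ.Point) : ℝ :=
  interp (fun u => interp (g u) y) x + edgeGreen x y

theorem interp_pt_of_mem (f : V → ℝ) {e : E} {t : ℝ} (ht : t ∈ Icc 0 (Γ.length e)) :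
    interp f (Γ.pt e t) = f (Γ.src e) + (f (Γ.tgt e) - f (Γ.src e)) * (t / Γ.length e) := by
  have hL := (Γ.length_pos e).ne'
  rcases ht.1.eq_or_lt with rfl | h0
  · simp [pt_zero, interp]
  rcases ht.2.eq_or_lt with rfl | h1
  · simp [pt_length, interp, hL]
  simp [pt_of_mem_Ioo h0 h1, interp]

theorem interp_pt (f : V → ℝ) (e : E) (t : ℝ) : interp f (Γ.pt e t) =
    f (Γ.src e) + (f (Γ.tgt e) - f (Γ.src e)) * (Γ.clamp e t / Γ.length e) := by
  rw [← pt_clamp, interp_pt_of_mem f (clamp_mem e t)]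

theorem edgeGreen_vertex_left (v : V) (x : Γ.Point) : edgeGreen (.vertex v) x = 0 := by
  cases x <;> rfl

theorem edgeGreen_vertex_right (v : V) (x : Γ.Point) : edgeGreen x (.vertex v) = 0 := by
  cases x <;> rfl

theorem edgeGreen_comm (x y : Γ.Point) : edgeGreen x y = edgeGreen y x := by
  cases x <;> cases y <;> try rfl
  rename_i e t _ _ e' s _ _
  by_cases h : e = e'
  · subst h; simp [edgeGreen, min_comm, mul_comm]
  · simp [edgeGreen, h, Ne.symm h]

-- The formula vanishes at t = 0 and t = L, so it also covers the vertices at the two ends.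
open Classical in
theorem edgeGreen_pt_inner {e e' : E} {t s : ℝ} (ht : t ∈ Icc 0 (Γ.length e)) (h0 h1) :
    edgeGreen (Γ.pt e t) (.inner e' s h0 h1) =
      if e = e' then min t s - t * s / Γ.length e else 0 := by
  have hL := (Γ.length_pos e).ne'
  rcases ht.1.eq_or_lt with rfl | h0'
  · simp [pt_zero, edgeGreen, h0.le]
  rcases ht.2.eq_or_lt with rfl | h1'
  · rw [pt_length, edgeGreen_vertex_left]
    split_ifs with h
    · subst h; rw [min_eq_right h1.le]; field_simp; ring
    · rfl
  simp [pt_of_mem_Ioo h0' h1', edgeGreen]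

open Classical in
theorem edgeGreen_pt_pt (e e' : E) (t s : ℝ) :
    edgeGreen (Γ.pt e t) (Γ.pt e' s) = if e = e' then
      min (Γ.clamp e t) (Γ.clamp e' s) - Γ.clamp e t * Γ.clamp e' s / Γ.length e else 0 := by
  rw [← pt_clamp e, ← pt_clamp e']
  have ht := clamp_mem (Γ := Γ) e t
  have hs := clamp_mem (Γ := Γ) e' s
  generalize Γ.clamp e t = t at *
  generalize Γ.clamp e' s = s at *
  rcases hs.1.eq_or_lt with rfl | h0
  · rw [pt_zero, edgeGreen_vertex_right, min_eq_right ht.1]; simp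
  rcases hs.2.eq_or_lt with rfl | h1
  · rw [pt_length, edgeGreen_vertex_right]
    split_ifs with h
    · subst h; rw [min_eq_left ht.2]; field_simp [(Γ.length_pos e).ne']; ring
    · rfl
  rw [pt_of_mem_Ioo h0 h1, edgeGreen_pt_inner ht]

theorem isPiecewiseAffine_interp (f : V → ℝ) : Γ.IsPiecewiseAffine (interp f) := by
  refine ⟨continuous_iff_forall_pt.2 fun e => ?_, fun e => ⟨∅, finite_empty, fun t ht => ?_⟩⟩
  · simp only [interp_pt]; fun_prop
  · refine ⟨(f (Γ.tgt e) - f (Γ.src e)) / Γ.length e, ?_⟩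
    filter_upwards [isOpen_Ioo.mem_nhds ht.1] with s hs
    rw [interp_pt_of_mem _ (Ioo_subset_Icc_self hs), interp_pt_of_mem _ (Ioo_subset_Icc_self ht.1)]
    ring

theorem rightSlope_interp (f : V → ℝ) {e : E} {t : ℝ} (ht : t ∈ Ico 0 (Γ.length e)) :
    Γ.rightSlope (interp f) e t = (f (Γ.tgt e) - f (Γ.src e)) / Γ.length e := by
  apply rightSlope_eq
  filter_upwards [Icc_mem_nhdsGE ht.2] with s hs
  rw [interp_pt_of_mem _ ⟨ht.1.trans hs.1, hs.2⟩, interp_pt_of_mem _ ⟨ht.1, ht.2.le⟩]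
  ring

theorem leftSlope_interp (f : V → ℝ) {e : E} {t : ℝ} (ht : t ∈ Ioc 0 (Γ.length e)) :
    Γ.leftSlope (interp f) e t = (f (Γ.tgt e) - f (Γ.src e)) / Γ.length e := by
  apply leftSlope_eq
  filter_upwards [Icc_mem_nhdsLE ht.1] with s hs
  rw [interp_pt_of_mem _ ⟨hs.1, hs.2.trans ht.2⟩, interp_pt_of_mem _ ⟨ht.1.le, ht.2⟩]
  ring

theorem laplacian_interp_inner [Fintype E] (f : V → ℝ) {e : E} {t : ℝ} (h0 h1) :
    Γ.laplacian (interp f) (.inner e t h0 h1) = 0 := by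
  simp only [laplacian]
  rw [rightSlope_interp f ⟨h0.le, h1⟩, leftSlope_interp f ⟨h0, h1.le⟩]
  ring

/-- Discrete Green identity: links the pointwise Laplacian to the weak formulation in `IsGreen`. -/
theorem laplacian_interp_vertex [Fintype E] [DecidableEq V] (f : V → ℝ) (v : V) :
    Γ.laplacian (interp f) (.vertex v) = Γ.energy f (Pi.single v 1) := by
  simp only [laplacian, energy, ← Finset.sum_neg_distrib]
  refine Finset.sum_congr rfl fun e _ => ?_
  rw [rightSlope_interp f ⟨le_rfl, Γ.length_pos e⟩, leftSlope_interp f ⟨Γ.length_pos e, le_rfl⟩]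
  simp only [Pi.single_apply]
  split_ifs <;> ring

theorem edgeGreen_self_pt {e : E} {t s : ℝ} (ht : t ∈ Icc 0 (Γ.length e)) (h0 h1) :
    edgeGreen (Γ.pt e t) (.inner e s h0 h1) = min t s - t * s / Γ.length e := by
  classical rw [edgeGreen_pt_inner ht, if_pos rfl]

theorem edgeGreen_pt_of_ne {e e' : E} (h : e ≠ e') (t s : ℝ) (h0 h1) :
    edgeGreen (Γ.pt e t) (.inner e' s h0 h1) = 0 := by
  classical rw [← pt_clamp, edgeGreen_pt_inner (clamp_mem e t), if_neg h]

theorem continuous_edgeGreen (y : Γ.Point) : Continuous fun x : Γ.Point => edgeGreen x y := by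
  classical
  cases y with
  | vertex v => simpa only [edgeGreen_vertex_right] using continuous_const
  | inner e' s h0 h1 =>
    refine continuous_iff_forall_pt.2 fun e => ?_
    rw [← pt_of_mem_Ioo h0 h1]
    simp only [edgeGreen_pt_pt]
    split_ifs <;> fun_prop

theorem isPiecewiseAffine_edgeGreen (y : Γ.Point) :
    Γ.IsPiecewiseAffine fun x => edgeGreen x y := by
  refine ⟨continuous_edgeGreen y, fun e => ?_⟩
  cases y with
  | vertex v =>
    exact ⟨∅, finite_empty, fun t _ => ⟨0, by simp [edgeGreen_vertex_right]⟩⟩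
  | inner e' s h0 h1 =>
    by_cases he : e = e'
    · subst he
      refine ⟨{s}, finite_singleton s, fun t ht => ?_⟩
      have hmem : ∀ᶠ u in 𝓝 t, u ∈ Icc 0 (Γ.length e) :=
        mem_of_superset (isOpen_Ioo.mem_nhds ht.1) Ioo_subset_Icc_self
      rcases lt_or_gt_of_ne (show t ≠ s from ht.2) with hts | hts
      · refine ⟨1 - s / Γ.length e, ?_⟩
        filter_upwards [hmem, Iio_mem_nhds hts] with u hu hus
        rw [edgeGreen_self_pt hu, edgeGreen_self_pt (Ioo_subset_Icc_self ht.1),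
          min_eq_left hts.le, min_eq_left (le_of_lt hus)]
        ring
      · refine ⟨- s / Γ.length e, ?_⟩
        filter_upwards [hmem, Ioi_mem_nhds hts] with u hu hus
        rw [edgeGreen_self_pt hu, edgeGreen_self_pt (Ioo_subset_Icc_self ht.1),
          min_eq_right hts.le, min_eq_right (le_of_lt hus)]
        ring
    · exact ⟨∅, finite_empty, fun t _ => ⟨0, by simp [edgeGreen_pt_of_ne he]⟩⟩

theorem rightSlope_edgeGreen_of_lt {e : E} {s t : ℝ} (h0 h1) (ht0 : 0 ≤ t) (hts : t < s) :
    Γ.rightSlope (fun x => edgeGreen x (.inner e s h0 h1)) e t = 1 - s / Γ.length e := by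
  apply rightSlope_eq
  filter_upwards [Icc_mem_nhdsGE hts] with u hu
  rw [edgeGreen_self_pt ⟨ht0.trans hu.1, hu.2.trans h1.le⟩,
    edgeGreen_self_pt ⟨ht0, hts.le.trans h1.le⟩, min_eq_left hts.le, min_eq_left hu.2]
  ring

theorem rightSlope_edgeGreen_of_le {e : E} {s t : ℝ} (h0 h1) (hst : s ≤ t)
    (htL : t < Γ.length e) :
    Γ.rightSlope (fun x => edgeGreen x (.inner e s h0 h1)) e t = - s / Γ.length e := by
  apply rightSlope_eq
  filter_upwards [Icc_mem_nhdsGE htL] with u hu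
  rw [edgeGreen_self_pt ⟨(h0.le.trans hst).trans hu.1, hu.2⟩,
    edgeGreen_self_pt ⟨h0.le.trans hst, htL.le⟩, min_eq_right hst, min_eq_right (hst.trans hu.1)]
  ring

theorem leftSlope_edgeGreen_of_le {e : E} {s t : ℝ} (h0 h1) (ht0 : 0 < t) (hts : t ≤ s) :
    Γ.leftSlope (fun x => edgeGreen x (.inner e s h0 h1)) e t = 1 - s / Γ.length e := by
  apply leftSlope_eq
  filter_upwards [Icc_mem_nhdsLE ht0] with u hu
  rw [edgeGreen_self_pt ⟨hu.1, hu.2.trans (hts.trans h1.le)⟩,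
    edgeGreen_self_pt ⟨ht0.le, hts.trans h1.le⟩, min_eq_left hts, min_eq_left (hu.2.trans hts)]
  ring

theorem leftSlope_edgeGreen_of_lt {e : E} {s t : ℝ} (h0 h1) (hst : s < t)
    (htL : t ≤ Γ.length e) :
    Γ.leftSlope (fun x => edgeGreen x (.inner e s h0 h1)) e t = - s / Γ.length e := by
  apply leftSlope_eq
  filter_upwards [Icc_mem_nhdsLE hst] with u hu
  rw [edgeGreen_self_pt ⟨h0.le.trans hu.1, hu.2.trans htL⟩,
    edgeGreen_self_pt ⟨h0.le.trans hst.le, htL⟩, min_eq_right hst.le, min_eq_right hu.1]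
  ring

theorem rightSlope_edgeGreen_of_ne {e e' : E} (h : e ≠ e') (s t : ℝ) (h0 h1) :
    Γ.rightSlope (fun x => edgeGreen x (.inner e' s h0 h1)) e t = 0 :=
  rightSlope_eq (by simp [edgeGreen_pt_of_ne h])

theorem leftSlope_edgeGreen_of_ne {e e' : E} (h : e ≠ e') (s t : ℝ) (h0 h1) :
    Γ.leftSlope (fun x => edgeGreen x (.inner e' s h0 h1)) e t = 0 :=
  leftSlope_eq (by simp [edgeGreen_pt_of_ne h])

-- The slope drops from 1 - s/L to -s/L at the source and nowhere else inside an edge.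
open Classical in
theorem laplacian_edgeGreen_inner [Fintype E] (y : Γ.Point) {e : E} {t : ℝ} (h0 h1) :
    Γ.laplacian (fun x => edgeGreen x y) (.inner e t h0 h1) =
      if .inner e t h0 h1 = y then 1 else 0 := by
  simp only [laplacian]
  cases y with
  | vertex v =>
    rw [rightSlope_eq (m := 0) (by simp [edgeGreen_vertex_right]),
      leftSlope_eq (m := 0) (by simp [edgeGreen_vertex_right])]
    simp
  | inner e' s h0' h1' =>
    by_cases he : e = e'
    · subst he
      rcases lt_trichotomy t s with h | h | h
      · rw [rightSlope_edgeGreen_of_lt _ _ h0.le h, leftSlope_edgeGreen_of_le _ _ h0 h.le]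
        simp [h.ne]
      · subst h
        rw [rightSlope_edgeGreen_of_le _ _ le_rfl h1, leftSlope_edgeGreen_of_le _ _ h0 le_rfl]
        simp; ring
      · rw [rightSlope_edgeGreen_of_le _ _ h.le h1, leftSlope_edgeGreen_of_lt _ _ h h1.le]
        simp [h.ne']
    · rw [rightSlope_edgeGreen_of_ne he, leftSlope_edgeGreen_of_ne he]
      simp [he]

-- The unit current injected at parameter s leaves through the ends in the proportions 1 - s/L and
-- s/L, which are the interpolation weights of y.
open Classical in
theorem laplacian_edgeGreen_vertex [Fintype E] (y : Γ.Point) (v : V) :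
    Γ.laplacian (fun x => edgeGreen x y) (.vertex v) =
      (if .vertex v = y then 1 else 0) - interp (Pi.single v 1) y := by
  simp only [laplacian]
  cases y with
  | vertex w =>
    rw [Finset.sum_eq_zero]
    · simp [interp, Pi.single_apply, eq_comm]
    · intro e _
      rw [rightSlope_eq (m := 0) (by simp [edgeGreen_vertex_right]),
        leftSlope_eq (m := 0) (by simp [edgeGreen_vertex_right])]
      simp
  | inner e' s h0 h1 =>
    rw [Finset.sum_eq_single e']
    · rw [rightSlope_edgeGreen_of_lt _ _ le_rfl h0, leftSlope_edgeGreen_of_lt _ _ h1 le_rfl]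
      simp only [interp, Pi.single_apply, reduceCtorEq, if_false]
      split_ifs <;> ring
    · intro e _ he
      rw [rightSlope_edgeGreen_of_ne he, leftSlope_edgeGreen_of_ne he]
      simp
    · simp

theorem isPiecewiseAffine_green (g : V → V → ℝ) (y : Γ.Point) :
    Γ.IsPiecewiseAffine fun x => green g x y := by
  simpa [green] using (isPiecewiseAffine_interp (fun u => interp (g u) y)).linearCombination
    (isPiecewiseAffine_edgeGreen y) 1 1

theorem interp_interp_comm (g : V → V → ℝ) (x y : Γ.Point) :
    interp (fun u => interp (g u) y) x = interp (fun v => interp (fun u => g u v) x) y := by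
  cases x <;> cases y <;> simp only [interp] <;> ring

theorem IsGreen.green_comm [Fintype E] {o : V} {g : V → V → ℝ} (hg : Γ.IsGreen o g)
    (x y : Γ.Point) : green g x y = green g y x := by
  rw [green, green, interp_interp_comm, edgeGreen_comm]
  congr 3
  ext v
  congr 1
  ext u
  exact hg.symm u v

theorem energy_interp [Fintype E] (g : V → V → ℝ) (h : V → ℝ) (y : Γ.Point) :
    Γ.energy (fun u => interp (fun v => g v u) y) h = interp (fun v => Γ.energy (g v) h) y := by
  cases y with
  | vertex v => rfl
  | inner e t _ _ =>
    simp only [interp, energy, ← Finset.sum_sub_distrib, Finset.sum_mul, ← Finset.sum_add_distrib]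
    refine Finset.sum_congr rfl fun e _ => ?_
    ring

theorem IsGreen.interp_symm [Fintype E] {o : V} {g : V → V → ℝ} (hg : Γ.IsGreen o g)
    (y : Γ.Point) : (fun u => interp (g u) y) = fun u => interp (fun v => g v u) y := by
  ext u; congr 1; ext v; exact hg.symm u v

-- The current that `edgeGreen` discharges at the ends of the edge of y is exactly what the
-- interpolated vertex Green function injects there; the two cancel, leaving δ_y - δ_o.
open Classical in
theorem IsGreen.laplacian_green [Fintype E] {o : V} {g : V → V → ℝ} (hg : Γ.IsGreen o g)
    (y p : Γ.Point) : Γ.laplacian (fun x => green g x y) p =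
      (if p = y then 1 else 0) - if p = .vertex o then 1 else 0 := by
  have h := laplacian_linearCombination (isPiecewiseAffine_interp (fun u => interp (g u) y))
    (isPiecewiseAffine_edgeGreen y) 1 1 p
  simp only [one_mul] at h
  change Γ.laplacian (fun x => green g x y) p = _ at h
  rw [h]
  cases p with
  | vertex v =>
    rw [laplacian_interp_vertex, laplacian_edgeGreen_vertex, hg.interp_symm, energy_interp]
    simp only [hg.energy_eq]
    have : interp (fun w => (Pi.single v 1 : V → ℝ) w - (Pi.single v 1 : V → ℝ) o) y =
        interp (Pi.single v 1) y - if v = o then 1 else 0 := by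
      cases y <;> simp only [interp, Pi.single_apply, eq_comm (a := o)] <;> ring
    rw [this]
    simp only [Point.vertex.injEq]
    ring
  | inner e t h0 h1 =>
    rw [laplacian_interp_inner, laplacian_edgeGreen_inner]
    simp

/-- A continuous piecewise affine function with vanishing Laplacian is affine on every edge. -/
theorem eq_interp_of_laplacian_eq_zero [Fintype E] {f : Γ.Point → ℝ} (hf : Γ.IsPiecewiseAffine f)
    (hl : ∀ p, Γ.laplacian f p = 0) : f = interp fun v => f (.vertex v) := by
  ext x
  cases x with
  | vertex v => rfl
  | inner e t h0 h1 =>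
    have hL := Γ.length_pos e
    obtain ⟨m, hm⟩ := exists_slope_of_locally_affine hL (hf.1.comp (continuous_pt e))
      fun s hs => ⟨Γ.rightSlope f e s, by
        -- A vanishing Laplacian at an interior point makes the one-sided slopes agree, so the two
        -- one-sided affine expansions glue.
        have h := hl (.inner e s hs.1 hs.2)
        simp only [laplacian] at h
        have h' : Γ.leftSlope f e s = Γ.rightSlope f e s := by linarith
        have hr := hf.exists_right ⟨hs.1.le, hs.2⟩
        have hl := hf.exists_left ⟨hs.1, hs.2.le⟩
        rw [h'] at hl
        rw [← nhdsLE_sup_nhdsGE]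
        exact eventually_sup.2 ⟨hl, hr⟩⟩
    have h1' := hm t ⟨h0.le, h1.le⟩
    have h2' := hm _ (right_mem_Icc.2 hL.le)
    simp only [Function.comp, pt_of_mem_Ioo h0 h1, pt_zero, pt_length] at h1' h2'
    simp only [interp]
    rw [h1', h2']
    field_simp
    ring

/-- A harmonic f is determined by its vertex values, and pairing these with `g v` gives f(v) - f(o)
on one side and a combination of Laplacians of f, that is 0, on the other. -/
theorem IsGreen.eq_const [Fintype E] [Finite V] {o : V} {g : V → V → ℝ} (hg : Γ.IsGreen o g)
    {f : Γ.Point → ℝ} (hf : Γ.IsPiecewiseAffine f) (hl : ∀ p, Γ.laplacian f p = 0)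
    (x : Γ.Point) : f x = f (.vertex o) := by
  classical
  cases nonempty_fintype V
  have hi := eq_interp_of_laplacian_eq_zero hf hl
  have hv : ∀ v, f (.vertex v) = f (.vertex o) := by
    intro v
    have h1 := hg.energy_eq v fun v => f (.vertex v)
    rw [energy_comm, energy_sum_right, Finset.sum_eq_zero] at h1
    · linarith
    · intro w _
      rw [← laplacian_interp_vertex, ← hi, hl, mul_zero]
  rw [hi]
  cases x <;> simp [interp, hv]

/-- In the difference of the potentials from y and from z the currents at the ground o cancel; the
last two terms are a constant that normalizes the value at z to 0. -/
theorem IsGreen.isVoltage [Fintype E] {o : V} {g : V → V → ℝ} (hg : Γ.IsGreen o g)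
    (z y : Γ.Point) : Γ.IsVoltage z y
      fun x => green g x y - green g x z - green g z y + green g z z := by
  have hlin := (isPiecewiseAffine_green g y).linearCombination (isPiecewiseAffine_green g z) 1 (-1)
  have hconst : Γ.IsPiecewiseAffine (interp fun _ : V => green g z z - green g z y) :=
    isPiecewiseAffine_interp _
  have hcv : ∀ x : Γ.Point, interp (fun _ : V => green g z z - green g z y) x =
      green g z z - green g z y := fun x => by cases x <;> simp [interp]
  have heq : (fun x => green g x y - green g x z - green g z y + green g z z) = fun x =>
      1 * (1 * green g x y + (-1) * green g x z) +
        1 * interp (fun _ : V => green g z z - green g z y) x := by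
    ext x; rw [hcv]; ring
  refine ⟨heq ▸ hlin.linearCombination hconst 1 1, by ring, fun p => ?_⟩
  rw [heq, laplacian_linearCombination hlin hconst, laplacian_linearCombination
    (isPiecewiseAffine_green g y) (isPiecewiseAffine_green g z), hg.laplacian_green,
    hg.laplacian_green]
  have : Γ.laplacian (interp fun _ : V => green g z z - green g z y) p = 0 := by
    classical
    cases p with
    | vertex v => rw [laplacian_interp_vertex]; simp [energy]
    | inner e t h0 h1 => exact laplacian_interp_inner _ _ _
  rw [this]
  ring

/-- The voltage selected by `epsilon` and the explicit one differ by a harmonic function, constant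
and zero at z. -/
theorem IsGreen.voltage_eq [Fintype E] [Finite V] {o : V} {g : V → V → ℝ} (hg : Γ.IsGreen o g)
    (z x y : Γ.Point) :
    Γ.voltage z x y = green g x y - green g x z - green g z y + green g z z := by
  have h1 := hg.isVoltage z y
  have h2 : Γ.IsVoltage z y (Classical.epsilon (Γ.IsVoltage z y)) := Classical.epsilon_spec ⟨_, h1⟩
  have hpa := h2.1.linearCombination h1.1 1 (-1)
  have hl := fun p => laplacian_linearCombination h2.1 h1.1 1 (-1) p
  have hc := hg.eq_const hpa fun p => by rw [hl, h2.2.2, h1.2.2]; ring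
  have hx := hc x
  rw [← hc z, h2.2.1] at hx
  unfold voltage
  linarith

end MetrizedGraph

/-! ### Integration against signed measures, and elementary integrals -/

/-- A signed measure is a difference of finite measures, and so is its integral. -/
theorem exists_finite_measure_sub {X : Type*} [MeasurableSpace X] (μ : SignedMeasure X) :
    ∃ P N : Measure X, IsFiniteMeasure P ∧ IsFiniteMeasure N ∧ ∀ f : X → ℝ,
      Measurable f → (∃ C, ∀ x, |f x| ≤ C) →
        ∫ᵛ x, f x ∂<•μ = ∫ x, f x ∂P - ∫ x, f x ∂N := by
  refine ⟨μ.toJordanDecomposition.posPart, μ.toJordanDecomposition.negPart, inferInstance,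
    inferInstance, fun f hf ⟨C, hC⟩ => ?_⟩
  have hint : ∀ P : Measure X, IsFiniteMeasure P → Integrable f P := fun P _ =>
    Integrable.of_bound hf.aestronglyMeasurable C (Eventually.of_forall fun x => by simpa using hC x)
  conv_lhs => rw [← μ.toSignedMeasure_toJordanDecomposition, JordanDecomposition.toSignedMeasure]
  rw [VectorMeasure.integral_sub_vectorMeasure, VectorMeasure.integral_toSignedMeasure,
    VectorMeasure.integral_toSignedMeasure]
  all_goals
    rw [VectorMeasure.Integrable, Measure.variation_toSignedMeasure]
    exact hint _ inferInstance

theorem isFiniteMeasure_variation {X : Type*} [MeasurableSpace X] (μ : SignedMeasure X) :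
    IsFiniteMeasure μ.variation := by
  rw [← SignedMeasure.totalVariation_eq_variation, SignedMeasure.totalVariation]
  infer_instance

/-- Fubini for an interval and a signed measure. -/
theorem integral_signedMeasure_intervalIntegral_comm {X : Type*} [MeasurableSpace X]
    (μ : SignedMeasure X) {L : ℝ} (hL : 0 ≤ L) {F : X → ℝ → ℝ} (hm : ∀ t, Measurable fun x => F x t)
    (hc : ∀ x, Continuous (F x)) {C : ℝ} (hC : ∀ x t, |F x t| ≤ C) :
    ∫ᵛ x, (∫ t in (0 : ℝ)..L, F x t) ∂<•μ = ∫ t in (0 : ℝ)..L, ∫ᵛ x, F x t ∂<•μ := by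
  obtain ⟨P, N, hP, hN, h⟩ := exists_finite_measure_sub μ
  -- Carathéodory: measurable in x and continuous in t implies jointly measurable.
  have hjoint : Measurable (Function.uncurry F) := by
    have := measurable_uncurry_of_continuous_of_measurable (u := fun t x => F x t) hc hm
    exact this.comp measurable_swap
  have hsm : StronglyMeasurable (Function.uncurry F) := hjoint.stronglyMeasurable
  have hprod : ∀ Q : Measure X, IsFiniteMeasure Q →
      Integrable (Function.uncurry F) (Q.prod (volume.restrict (Ioc 0 L))) := fun Q _ =>
    Integrable.of_bound hjoint.aestronglyMeasurable C
      (Eventually.of_forall fun x => hC x.1 x.2)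
  have hswap : ∀ Q : Measure X, IsFiniteMeasure Q →
      ∫ x, (∫ t in (0 : ℝ)..L, F x t) ∂Q = ∫ t in (0 : ℝ)..L, ∫ x, F x t ∂Q := fun Q hQ => by
    simp only [intervalIntegral.integral_of_le hL]
    exact integral_integral_swap (hprod Q hQ)
  rw [h, hswap P hP, hswap N hN, ← intervalIntegral.integral_sub]
  · exact intervalIntegral.integral_congr fun t _ => (h _ (hm t) ⟨C, fun x => hC x t⟩).symm
  · rw [intervalIntegrable_iff_integrableOn_Ioc_of_le hL]
    exact (hprod P hP).integral_prod_right
  · rw [intervalIntegrable_iff_integrableOn_Ioc_of_le hL]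
    exact (hprod N hN).integral_prod_right
  · simp only [intervalIntegral.integral_of_le hL]
    exact (hsm.integral_prod_right (ν := volume.restrict (Ioc 0 L))).measurable
  · refine ⟨C * |L - 0|, fun x => ?_⟩
    exact intervalIntegral.norm_integral_le_of_norm_le_const (f := F x) fun t _ => hC x t

theorem integral_min_sub_mul_div {L s : ℝ} (hL : 0 < L) (hs : s ∈ Icc 0 L) :
    ∫ t in (0 : ℝ)..L, (min t s - t * s / L) = s * (L - s) / 2 := by
  have hmin : IntervalIntegrable (fun t => min t s) volume 0 L :=
    Continuous.intervalIntegrable (by fun_prop) _ _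
  rw [intervalIntegral.integral_sub hmin (Continuous.intervalIntegrable (by fun_prop) _ _),
    ← intervalIntegral.integral_add_adjacent_intervals (b := s)
      (Continuous.intervalIntegrable (by fun_prop) _ _)
      (Continuous.intervalIntegrable (by fun_prop) _ _)]
  have h1 : ∫ t in (0 : ℝ)..s, min t s = ∫ t in (0 : ℝ)..s, t :=
    intervalIntegral.integral_congr fun t ht => by
      rw [uIcc_of_le hs.1] at ht; exact min_eq_left ht.2
  have h2 : ∫ t in s..L, min t s = ∫ t in s..L, s :=
    intervalIntegral.integral_congr fun t ht => by
      rw [uIcc_of_le hs.2] at ht; exact min_eq_right ht.1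
  have h3 : ∫ t in (0 : ℝ)..L, t * s / L = (s / L) * ∫ t in (0 : ℝ)..L, t := by
    rw [← intervalIntegral.integral_const_mul]; congr 1; ext t; ring
  rw [h1, h2, h3, integral_id, intervalIntegral.integral_const, integral_id, smul_eq_mul]
  field_simp
  ring

theorem integral_affine_div {a b L : ℝ} (hL : 0 < L) :
    ∫ t in (0 : ℝ)..L, (a + (b - a) * (t / L)) = L * (a + b) / 2 := by
  have h : ∫ t in (0 : ℝ)..L, (a + (b - a) * (t / L)) =
      (∫ _ in (0 : ℝ)..L, a) + ((b - a) / L) * ∫ t in (0 : ℝ)..L, t := by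
    rw [← intervalIntegral.integral_const_mul, ← intervalIntegral.integral_add]
    · congr 1; ext t; ring
    · exact Continuous.intervalIntegrable (by fun_prop) _ _
    · exact Continuous.intervalIntegrable (by fun_prop) _ _
  rw [h, integral_id, intervalIntegral.integral_const, smul_eq_mul]
  field_simp
  ring

theorem integral_mul_sub_self (w L : ℝ) :
    ∫ t in (0 : ℝ)..L, w * (t * (L - t)) = w * L ^ 3 / 6 := by
  have h : ∫ t in (0 : ℝ)..L, w * (t * (L - t)) =
      (w * L) * (∫ t in (0 : ℝ)..L, t) - w * ∫ t in (0 : ℝ)..L, t ^ 2 := by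
    rw [← intervalIntegral.integral_const_mul, ← intervalIntegral.integral_const_mul,
      ← intervalIntegral.integral_sub]
    · congr 1; ext t; ring
    · exact Continuous.intervalIntegrable (by fun_prop) _ _
    · exact Continuous.intervalIntegrable (by fun_prop) _ _
  rw [h, integral_id, integral_pow]
  norm_num
  ring

/-! ### The canonical measure in closed form and the resulting formula for τ -/

namespace MetrizedGraph

variable {V E : Type*} {Γ : MetrizedGraph V E}

variable (Γ) in
/-- Integration against the signed measure with mass `m v` at each vertex `v` and density `w e`
on each edge `e`. -/
noncomputable def weightedIntegral [Fintype V] [Fintype E] (m : V → ℝ) (w : E → ℝ)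
    (f : Γ.Point → ℝ) : ℝ :=
  ∑ v, m v * f (.vertex v) + ∑ e, w e * ∫ t in (0 : ℝ)..Γ.length e, f (Γ.pt e t)

variable (Γ) in
/-- The signed measure with mass `m v` at each vertex `v` and density `w e` on each edge `e`. -/
noncomputable def weightedMeasure [Fintype V] [Fintype E] (m : V → ℝ) (w : E → ℝ) :
    SignedMeasure Γ.Point :=
  ∑ v, m v • (Measure.dirac (Point.vertex v : Γ.Point)).toSignedMeasure +
    ∑ e, w e • ((volume.restrict (Ioc 0 (Γ.length e))).map (Γ.pt e)).toSignedMeasure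

theorem weightedIntegral_add [Fintype V] [Fintype E] (m : V → ℝ) (w : E → ℝ)
    {f h : Γ.Point → ℝ} (hf : Continuous f) (hh : Continuous h) :
    Γ.weightedIntegral m w (fun x => f x + h x) =
      Γ.weightedIntegral m w f + Γ.weightedIntegral m w h := by
  simp only [weightedIntegral]
  have : ∀ e, ∫ t in (0 : ℝ)..Γ.length e, (f (Γ.pt e t) + h (Γ.pt e t)) =
      (∫ t in (0 : ℝ)..Γ.length e, f (Γ.pt e t)) + ∫ t in (0 : ℝ)..Γ.length e, h (Γ.pt e t) :=
    fun e => intervalIntegral.integral_add ((hf.comp (continuous_pt e)).intervalIntegrable _ _)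
      ((hh.comp (continuous_pt e)).intervalIntegrable _ _)
  simp only [this, mul_add, Finset.sum_add_distrib]
  ring

theorem weightedIntegral_const_mul [Fintype V] [Fintype E] (m : V → ℝ) (w : E → ℝ) (c : ℝ)
    (f : Γ.Point → ℝ) :
    Γ.weightedIntegral m w (fun x => c * f x) = c * Γ.weightedIntegral m w f := by
  simp only [weightedIntegral, intervalIntegral.integral_const_mul, mul_add, Finset.mul_sum]
  congr 1 <;> exact Finset.sum_congr rfl fun _ _ => by ring

/-- The canonical mass of a point of the edge `e`, per unit of length. -/
noncomputable def edgeDensity (Γ : MetrizedGraph V E) (g : V → V → ℝ) (e : E) : ℝ :=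
  1 / Γ.length e - (g (Γ.src e) (Γ.src e) + g (Γ.tgt e) (Γ.tgt e) -
    2 * g (Γ.src e) (Γ.tgt e)) / Γ.length e ^ 2

open Classical in
/-- The canonical mass of the vertex `v`. -/
noncomputable def vertexMass (Γ : MetrizedGraph V E) [Fintype E] (o : V) (g : V → V → ℝ) (v : V) :
    ℝ :=
  1 / 2 * Γ.energy (fun u => g u u) (Pi.single v 1) + (Pi.single v 1 : V → ℝ) o -
    1 / 2 * ∑ e, Γ.edgeDensity g e * Γ.length e *
      ((Pi.single v 1 : V → ℝ) (Γ.src e) + (Pi.single v 1 : V → ℝ) (Γ.tgt e))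

variable [Fintype E]

/-- `vertexMass` is designed for this: it subtracts the halves of edge masses that the trapezoid
rule assigns to the end points, leaving only the energy and the value at o. -/
theorem weightedIntegral_interp [Fintype V] (o : V) (g : V → V → ℝ) (f : V → ℝ) :
    Γ.weightedIntegral (Γ.vertexMass o g) (Γ.edgeDensity g) (interp f) =
      1 / 2 * Γ.energy (fun u => g u u) f + f o := by
  classical
  have hint : ∀ e, ∫ t in (0 : ℝ)..Γ.length e, interp f (Γ.pt e t) =
      Γ.length e * (f (Γ.src e) + f (Γ.tgt e)) / 2 := fun e => by
    rw [← integral_affine_div (Γ.length_pos e)]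
    refine intervalIntegral.integral_congr fun t ht => ?_
    rw [uIcc_of_le (Γ.length_pos e).le] at ht
    exact interp_pt_of_mem f ht
  have hsum : ∀ u, ∑ v, f v * (Pi.single v 1 : V → ℝ) u = f u := fun u => by
    simp [Pi.single_apply]
  have h3 : ∑ v, f v * ∑ e, Γ.edgeDensity g e * Γ.length e *
      ((Pi.single v 1 : V → ℝ) (Γ.src e) + (Pi.single v 1 : V → ℝ) (Γ.tgt e)) =
      ∑ e, Γ.edgeDensity g e * Γ.length e * (f (Γ.src e) + f (Γ.tgt e)) := by
    simp only [Finset.mul_sum]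
    rw [Finset.sum_comm]
    refine Finset.sum_congr rfl fun e _ => ?_
    rw [← hsum (Γ.src e), ← hsum (Γ.tgt e), ← Finset.sum_add_distrib, Finset.mul_sum]
    exact Finset.sum_congr rfl fun v _ => by ring
  have h4 : ∑ v, Γ.vertexMass o g v * f v = 1 / 2 * Γ.energy (fun u => g u u) f + f o -
      1 / 2 * ∑ e, Γ.edgeDensity g e * Γ.length e * (f (Γ.src e) + f (Γ.tgt e)) := by
    rw [← h3, energy_sum_right, ← hsum o, Finset.mul_sum, Finset.mul_sum,
      ← Finset.sum_add_distrib, ← Finset.sum_sub_distrib]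
    refine Finset.sum_congr rfl fun v _ => ?_
    simp only [vertexMass]
    ring
  have h6 : ∑ v, Γ.vertexMass o g v * (interp f (.vertex v : Γ.Point)) = _ := h4
  simp only [weightedIntegral, h6, hint]
  have h5 : ∑ e, Γ.edgeDensity g e * (Γ.length e * (f (Γ.src e) + f (Γ.tgt e)) / 2) =
      1 / 2 * ∑ e, Γ.edgeDensity g e * Γ.length e * (f (Γ.src e) + f (Γ.tgt e)) := by
    rw [Finset.mul_sum]; exact Finset.sum_congr rfl fun e _ => by ring
  rw [h5]; ring

/-- Constants have zero energy, so the total mass is 1. -/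
theorem weightedIntegral_const [Fintype V] (o : V) (g : V → V → ℝ) (c : ℝ) :
    Γ.weightedIntegral (Γ.vertexMass o g) (Γ.edgeDensity g) (fun _ => c) = c := by
  have h := weightedIntegral_interp (Γ := Γ) o g fun _ => c
  have hc : (interp fun _ : V => c) = fun _ : Γ.Point => c := by
    ext x; cases x <;> simp [interp]
  rw [hc] at h
  rw [h]; simp [energy]

/-- The deviation of the diagonal of the Green function from its affine interpolation. -/
noncomputable def diagExcess (g : V → V → ℝ) : Γ.Point → ℝ
  | .vertex _ => 0
  | .inner e t _ _ => Γ.edgeDensity g e * (t * (Γ.length e - t))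

omit [Fintype E] in
theorem diagExcess_pt_of_mem (g : V → V → ℝ) {e : E} {t : ℝ} (ht : t ∈ Icc 0 (Γ.length e)) :
    diagExcess g (Γ.pt e t) = Γ.edgeDensity g e * (t * (Γ.length e - t)) := by
  rcases ht.1.eq_or_lt with rfl | h0
  · simp [pt_zero, diagExcess]
  rcases ht.2.eq_or_lt with rfl | h1
  · simp [pt_length, diagExcess]
  simp [pt_of_mem_Ioo h0 h1, diagExcess]

omit [Fintype E] in
theorem continuous_diagExcess (g : V → V → ℝ) : Continuous (diagExcess g : Γ.Point → ℝ) := by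
  refine continuous_iff_forall_pt.2 fun e => ?_
  have : (fun t => diagExcess g (Γ.pt e t)) = fun t =>
      Γ.edgeDensity g e * (Γ.clamp e t * (Γ.length e - Γ.clamp e t)) := by
    ext t; rw [← pt_clamp, diagExcess_pt_of_mem g (clamp_mem e t)]
  rw [this]; fun_prop

/-- At parameter t, `edgeGreen` contributes t(L - t)/L and double interpolation on the diagonal
loses r_e t(L - t)/L²; the difference is the density times t(L - t). -/
theorem IsGreen.green_self {o : V} {g : V → V → ℝ} (hg : Γ.IsGreen o g) (x : Γ.Point) :
    green g x x = interp (fun v => g v v) x + diagExcess g x := by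
  cases x with
  | vertex v => simp [green, interp, diagExcess, edgeGreen]
  | inner e t h0 h1 =>
    have hL := (Γ.length_pos e).ne'
    simp only [green, interp, diagExcess, edgeGreen, edgeDensity, if_true, min_self]
    rw [hg.symm (Γ.tgt e) (Γ.src e)]
    field_simp
    ring

/-- The key property of the measure. The interpolated part gives half the interpolation of D at y
because g(·,y) reproduces D in the energy; the `edgeGreen` part gives half of `diagExcess`. -/
theorem IsGreen.weightedIntegral_green [Fintype V] {o : V} {g : V → V → ℝ} (hg : Γ.IsGreen o g)
    (y : Γ.Point) :
    Γ.weightedIntegral (Γ.vertexMass o g) (Γ.edgeDensity g) (fun x => green g x y) =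
      1 / 2 * green g y y := by
  simp only [green]
  rw [weightedIntegral_add _ _ (isPiecewiseAffine_interp _).1 (continuous_edgeGreen y)]
  change _ = 1 / 2 * green g y y
  rw [weightedIntegral_interp, hg.green_self, hg.interp_symm, energy_comm, energy_interp]
  have hgo : interp (g o) y = 0 := by cases y <;> simp [interp, hg.base_apply]
  simp only [hg.energy_eq, hg.base_apply, sub_zero]
  rw [hgo]
  have h1 : Γ.weightedIntegral (Γ.vertexMass o g) (Γ.edgeDensity g) (fun x => edgeGreen x y) =
      1 / 2 * diagExcess g y := by
    cases y with
    | vertex v => simp [weightedIntegral, edgeGreen_vertex_right, diagExcess]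
    | inner e s h0 h1 =>
      simp only [weightedIntegral, edgeGreen_vertex_left, mul_zero, Finset.sum_const_zero, zero_add]
      rw [Finset.sum_eq_single e]
      · have : ∫ t in (0 : ℝ)..Γ.length e, edgeGreen (Γ.pt e t) (.inner e s h0 h1) =
            s * (Γ.length e - s) / 2 := by
          rw [← integral_min_sub_mul_div (Γ.length_pos e) ⟨h0.le, h1.le⟩]
          refine intervalIntegral.integral_congr fun t ht => ?_
          rw [uIcc_of_le (Γ.length_pos e).le] at ht
          exact edgeGreen_self_pt ht _ _
        rw [this]
        simp only [diagExcess]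
        ring
      · intro e' _ he
        simp [edgeGreen_pt_of_ne he]
      · simp
  rw [h1]; ring

/-- The common value of the integrals of the resistance function against the canonical measure. -/
noncomputable def canonicalConstant (Γ : MetrizedGraph V E) (g : V → V → ℝ) : ℝ :=
  1 / 2 * Γ.energy (fun u => g u u) (fun u => g u u) +
    1 / 6 * ∑ e, Γ.edgeDensity g e ^ 2 * Γ.length e ^ 3

omit [Fintype E] in
theorem continuous_green_left (g : V → V → ℝ) (y : Γ.Point) :
    Continuous fun x : Γ.Point => green g x y :=
  (isPiecewiseAffine_green g y).1

theorem IsGreen.continuous_green_self {o : V} {g : V → V → ℝ} (hg : Γ.IsGreen o g) :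
    Continuous fun x : Γ.Point => green g x x := by
  simp only [hg.green_self]
  exact (isPiecewiseAffine_interp _).1.add (continuous_diagExcess g)

theorem IsGreen.voltage_self [Finite V] {o : V} {g : V → V → ℝ} (hg : Γ.IsGreen o g)
    (z x : Γ.Point) : Γ.voltage z x x = green g x x + (-2 * green g z x + green g z z) := by
  rw [hg.voltage_eq, hg.green_comm x z]; ring

theorem IsGreen.continuous_voltage_self [Finite V] {o : V} {g : V → V → ℝ} (hg : Γ.IsGreen o g)
    (x : Γ.Point) : Continuous fun z => Γ.voltage z x x := by
  simp only [hg.voltage_self]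
  have := continuous_green_left g x
  have := hg.continuous_green_self
  fun_prop

theorem IsGreen.voltage_self_comm [Finite V] {o : V} {g : V → V → ℝ} (hg : Γ.IsGreen o g)
    (z x : Γ.Point) : Γ.voltage z x x = Γ.voltage x z z := by
  rw [hg.voltage_self, hg.voltage_self, hg.green_comm x z]; ring

/-- In r(z,x) = g(x,x) - 2g(z,x) + g(z,z) the first two terms cancel after integration over z, so
the result does not depend on x. -/
theorem IsGreen.weightedIntegral_voltage [Fintype V] {o : V} {g : V → V → ℝ}
    (hg : Γ.IsGreen o g) (x : Γ.Point) :
    Γ.weightedIntegral (Γ.vertexMass o g) (Γ.edgeDensity g) (fun z => Γ.voltage z x x) =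
      Γ.canonicalConstant g := by
  have hc := continuous_green_left g x
  have hd := hg.continuous_green_self
  simp only [hg.voltage_self]
  rw [weightedIntegral_add _ _ continuous_const (by fun_prop),
    weightedIntegral_add _ _ (by fun_prop) hd, weightedIntegral_const_mul,
    hg.weightedIntegral_green, weightedIntegral_const]
  simp only [hg.green_self]
  rw [weightedIntegral_add _ _ (isPiecewiseAffine_interp _).1 (continuous_diagExcess g),
    weightedIntegral_interp, hg.base_apply]
  have : Γ.weightedIntegral (Γ.vertexMass o g) (Γ.edgeDensity g) (diagExcess g) =
      1 / 6 * ∑ e, Γ.edgeDensity g e ^ 2 * Γ.length e ^ 3 := by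
    have hv : ∀ v, diagExcess g (.vertex v : Γ.Point) = 0 := fun _ => rfl
    simp only [weightedIntegral, hv, mul_zero, Finset.sum_const_zero, zero_add, Finset.mul_sum]
    refine Finset.sum_congr rfl fun e _ => ?_
    have : ∫ t in (0 : ℝ)..Γ.length e, diagExcess g (Γ.pt e t) =
        ∫ t in (0 : ℝ)..Γ.length e, Γ.edgeDensity g e * (t * (Γ.length e - t)) := by
      refine intervalIntegral.integral_congr fun t ht => ?_
      rw [uIcc_of_le (Γ.length_pos e).le] at ht
      exact diagExcess_pt_of_mem g ht
    rw [this, integral_mul_sub_self]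
    ring
  rw [this, canonicalConstant]
  ring

theorem integral_weightedMeasure [Fintype V] (m : V → ℝ) (w : E → ℝ) {f : Γ.Point → ℝ}
    (hf : Continuous f) (hb : ∃ C, ∀ x, |f x| ≤ C) :
    ∫ᵛ x, f x ∂<•(Γ.weightedMeasure m w) = Γ.weightedIntegral m w f := by
  obtain ⟨C, hC⟩ := hb
  have hint : ∀ (c : ℝ) (P : Measure Γ.Point) [IsFiniteMeasure P],
      (c • P.toSignedMeasure).Integrable f := fun c P _ => by
    apply VectorMeasure.Integrable.smul_vectorMeasure
    rw [VectorMeasure.Integrable, Measure.variation_toSignedMeasure]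
    exact Integrable.of_bound hf.measurable.aestronglyMeasurable C
      (Eventually.of_forall fun x => by simpa using hC x)
  rw [weightedMeasure, VectorMeasure.integral_add_vectorMeasure,
    VectorMeasure.integral_finsetSum_vectorMeasure, VectorMeasure.integral_finsetSum_vectorMeasure]
  · simp only [VectorMeasure.integral_smul_vectorMeasure, VectorMeasure.integral_toSignedMeasure,
      weightedIntegral, smul_eq_mul]
    congr 1
    · refine Finset.sum_congr rfl fun v _ => ?_
      rw [integral_dirac' _ _ hf.measurable.stronglyMeasurable]
    · refine Finset.sum_congr rfl fun e _ => ?_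
      rw [integral_map (continuous_pt e).measurable.aemeasurable
        hf.measurable.aestronglyMeasurable, intervalIntegral.integral_of_le (Γ.length_pos e).le]
  · exact fun e _ => hint _ _
  · exact fun v _ => hint _ _
  · exact VectorMeasure.Integrable.finsetSum_vectorMeasure fun v _ => hint _ _
  · exact VectorMeasure.Integrable.finsetSum_vectorMeasure fun v _ => hint _ _

theorem weightedMeasure_univ [Fintype V] (o : V) (g : V → V → ℝ) :
    Γ.weightedMeasure (Γ.vertexMass o g) (Γ.edgeDensity g) univ = 1 := by
  have h := weightedIntegral_const (Γ := Γ) o g 1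
  simp only [weightedIntegral, mul_one, intervalIntegral.integral_const, sub_zero,
    smul_eq_mul] at h
  have hmap : ∀ e : E, ((volume.restrict (Ioc 0 (Γ.length e))).map (Γ.pt e)).real univ =
      Γ.length e := fun e => by
    rw [map_measureReal_apply (continuous_pt e).measurable MeasurableSet.univ]
    simp [(Γ.length_pos e).le]
  rw [← h, weightedMeasure]
  simp [hmap]

omit [Fintype E] in
theorem abs_interp_le {f : V → ℝ} {C : ℝ} (hC : ∀ v, |f v| ≤ C) (x : Γ.Point) :
    |interp f x| ≤ C := by
  cases x with
  | vertex v => exact hC v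
  | inner e t h0 h1 =>
    have hb : 0 ≤ t / Γ.length e := div_nonneg h0.le (Γ.length_pos e).le
    have ha : 0 ≤ 1 - t / Γ.length e := sub_nonneg.2 ((div_le_one (Γ.length_pos e)).2 h1.le)
    have h := convex_Icc (-C) C (abs_le.1 (hC (Γ.src e))) (abs_le.1 (hC (Γ.tgt e))) ha hb (by ring)
    have heq : interp f (.inner e t h0 h1) =
        (1 - t / Γ.length e) • f (Γ.src e) + (t / Γ.length e) • f (Γ.tgt e) := by
      simp only [interp, smul_eq_mul]; ring
    rw [abs_le, heq]
    exact h

theorem abs_edgeGreen_le (x y : Γ.Point) : |edgeGreen x y| ≤ ∑ e, Γ.length e := by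
  have hsum : 0 ≤ ∑ e, Γ.length e := Finset.sum_nonneg fun e _ => (Γ.length_pos e).le
  cases x with
  | vertex v => rwa [edgeGreen_vertex_left, abs_zero]
  | inner e t h0 h1 =>
    cases y with
    | vertex v => rwa [edgeGreen_vertex_right, abs_zero]
    | inner e' s h0' h1' =>
      by_cases he : e = e'
      · subst he
        have hle := Finset.single_le_sum (f := Γ.length) (fun e _ => (Γ.length_pos e).le)
          (Finset.mem_univ e)
        have hL := Γ.length_pos e
        have h2 : 0 ≤ t * s / Γ.length e := by positivity
        have h3 : t * s / Γ.length e ≤ Γ.length e := by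
          rw [div_le_iff₀ hL]; exact mul_le_mul h1.le h1'.le h0'.le hL.le
        have h4 : min t s ≤ Γ.length e := (min_le_left _ _).trans h1.le
        have h5 : 0 ≤ min t s := le_min h0.le h0'.le
        simp only [edgeGreen, if_true]
        rw [abs_le]
        constructor <;> linarith
      · simpa [edgeGreen, he] using hsum

theorem exists_abs_green_le [Finite V] (g : V → V → ℝ) :
    ∃ C, ∀ x y : Γ.Point, |green g x y| ≤ C := by
  obtain ⟨C, hC⟩ := (Set.finite_range fun p : V × V => |g p.1 p.2|).bddAbove
  refine ⟨C + ∑ e, Γ.length e, fun x y => (abs_add_le _ _).trans (add_le_add ?_ ?_)⟩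
  · exact abs_interp_le (fun u => abs_interp_le (fun v => hC ⟨(u, v), rfl⟩) y) x
  · exact abs_edgeGreen_le x y

theorem IsGreen.exists_abs_voltage_le [Finite V] {o : V} {g : V → V → ℝ} (hg : Γ.IsGreen o g) :
    ∃ C, ∀ z x : Γ.Point, |Γ.voltage z x x| ≤ C := by
  obtain ⟨C, hC⟩ := exists_abs_green_le (Γ := Γ) g
  refine ⟨4 * C, fun z x => ?_⟩
  rw [hg.voltage_self]
  have h1 := abs_le.1 (hC x x)
  have h2 := abs_le.1 (hC z x)
  have h3 := abs_le.1 (hC z z)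
  rw [abs_le]
  constructor <;> linarith

theorem IsGreen.voltageIntegral_weightedMeasure [Fintype V] {o : V} {g : V → V → ℝ}
    (hg : Γ.IsGreen o g) (x : Γ.Point) :
    Γ.voltageIntegral (Γ.weightedMeasure (Γ.vertexMass o g) (Γ.edgeDensity g)) x x =
      Γ.canonicalConstant g := by
  obtain ⟨C, hC⟩ := hg.exists_abs_voltage_le
  rw [voltageIntegral, integral_weightedMeasure _ _ (hg.continuous_voltage_self x)
    ⟨C, fun z => hC z x⟩, hg.weightedIntegral_voltage]

theorem IsGreen.isCanonicalMeasure [Fintype V] {o : V} {g : V → V → ℝ} (hg : Γ.IsGreen o g) :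
    Γ.IsCanonicalMeasure (Γ.weightedMeasure (Γ.vertexMass o g) (Γ.edgeDensity g)) :=
  ⟨weightedMeasure_univ o g, fun x y => by
    rw [hg.voltageIntegral_weightedMeasure, hg.voltageIntegral_weightedMeasure]⟩

theorem integral_weightedIntegral_comm [Fintype V] (μ : SignedMeasure Γ.Point) (m : V → ℝ)
    (w : E → ℝ) {F : Γ.Point → Γ.Point → ℝ} (h1 : ∀ y, Continuous fun x => F x y)
    (h2 : ∀ x, Continuous (F x)) {C : ℝ} (hC : ∀ x y, |F x y| ≤ C) :
    ∫ᵛ x, Γ.weightedIntegral m w (F x) ∂<•μ =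
      Γ.weightedIntegral m w fun y => ∫ᵛ x, F x y ∂<•μ := by
  have := isFiniteMeasure_variation μ
  have hv : ∀ v, μ.Integrable fun x => m v * F x (.vertex v) := fun v =>
    (Integrable.of_bound (h1 _).measurable.aestronglyMeasurable C
      (Eventually.of_forall fun x => hC x _)).const_mul _
  have hmeas : ∀ e, Measurable fun x => ∫ t in (0 : ℝ)..Γ.length e, F x (Γ.pt e t) := fun e => by
    have hjoint : StronglyMeasurable (Function.uncurry fun x t => F x (Γ.pt e t)) :=
      ((measurable_uncurry_of_continuous_of_measurable (u := fun t x => F x (Γ.pt e t))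
        (fun x => (h2 x).comp (continuous_pt e)) fun t => (h1 _).measurable).comp
          measurable_swap).stronglyMeasurable
    simp only [intervalIntegral.integral_of_le (Γ.length_pos e).le]
    exact (hjoint.integral_prod_right (ν := volume.restrict (Ioc 0 (Γ.length e)))).measurable
  have he : ∀ e, μ.Integrable fun x => w e * ∫ t in (0 : ℝ)..Γ.length e, F x (Γ.pt e t) :=
    fun e => (Integrable.of_bound (hmeas e).aestronglyMeasurable (C * |Γ.length e - 0|)
      (Eventually.of_forall fun x => intervalIntegral.norm_integral_le_of_norm_le_const
        (f := fun t => F x (Γ.pt e t)) fun t _ => hC x _)).const_mul _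
  simp only [weightedIntegral]
  rw [VectorMeasure.integral_fun_add (integrable_finsetSum _ fun v _ => hv v)
    (integrable_finsetSum _ fun e _ => he e), VectorMeasure.integral_finsetSum _ fun v _ => hv v,
    VectorMeasure.integral_finsetSum _ fun e _ => he e]
  have hmul : ∀ (c : ℝ) (f : Γ.Point → ℝ), ∫ᵛ x, c * f x ∂<•μ = c * ∫ᵛ x, f x ∂<•μ :=
    fun c f => VectorMeasure.integral_fun_smul μ _ c f
  simp only [hmul]
  congr 1
  refine Finset.sum_congr rfl fun e _ => ?_
  rw [integral_signedMeasure_intervalIntegral_comm μ (Γ.length_pos e).le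
    (fun t => (h1 _).measurable) (fun x => (h2 x).comp (continuous_pt e)) fun x t => hC x _]

/-- Uniqueness of the constant, without uniqueness of the measure: integrate r against μ and the
explicit measure in both orders; each order returns one of the two constants, as both total masses
are 1. -/
theorem IsGreen.voltageIntegral_eq [Fintype V] {o : V} {g : V → V → ℝ} (hg : Γ.IsGreen o g)
    {μ : SignedMeasure Γ.Point} (hμ : Γ.IsCanonicalMeasure μ) (x : Γ.Point) :
    Γ.voltageIntegral μ x x = Γ.canonicalConstant g := by
  obtain ⟨C, hC⟩ := hg.exists_abs_voltage_le
  have h := integral_weightedIntegral_comm μ (Γ.vertexMass o g) (Γ.edgeDensity g)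
    (F := fun z y => Γ.voltage z y y) (fun y => hg.continuous_voltage_self y)
    (fun z => by simpa only [hg.voltage_self_comm z] using hg.continuous_voltage_self z) hC
  have hl : ∀ z, Γ.weightedIntegral (Γ.vertexMass o g) (Γ.edgeDensity g)
      (fun y => Γ.voltage z y y) = Γ.canonicalConstant g := fun z => by
    simp only [hg.voltage_self_comm z]
    exact hg.weightedIntegral_voltage z
  have hr : ∀ y, ∫ᵛ z, Γ.voltage z y y ∂<•μ = Γ.voltageIntegral μ x x := fun y => hμ.2 y x
  simp only [hl, hr, weightedIntegral_const] at h
  have := isFiniteMeasure_variation μ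
  rw [VectorMeasure.integral_const, hμ.1] at h
  simpa using h.symm

theorem IsGreen.tau_eq [Finite V] {o : V} {g : V → V → ℝ} (hg : Γ.IsGreen o g) :
    Γ.tau = 1 / 2 * Γ.canonicalConstant g := by
  cases nonempty_fintype V
  have hex : ∃ t : ℝ, ∃ μ : SignedMeasure Γ.Point,
      Γ.IsCanonicalMeasure μ ∧ ∀ x : Γ.Point, t = (1 / 2) * Γ.voltageIntegral μ x x :=
    ⟨1 / 2 * Γ.canonicalConstant g, _, hg.isCanonicalMeasure, fun x => by
      rw [hg.voltageIntegral_weightedMeasure]⟩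
  obtain ⟨μ, hμ, h⟩ := Classical.epsilon_spec hex
  rw [tau, h (.vertex o), hg.voltageIntegral_eq hμ]

end MetrizedGraph

/-! ### Existence of Green functions, restoring an edge, and the integral A -/

namespace MetrizedGraph

variable {V E : Type*} {Γ : MetrizedGraph V E} [Fintype E]

theorem energy_add_left (f f' h : V → ℝ) :
    Γ.energy (f + f') h = Γ.energy f h + Γ.energy f' h := by
  simp only [energy, ← Finset.sum_add_distrib, Pi.add_apply]
  exact Finset.sum_congr rfl fun e _ => by ring

theorem energy_smul_left (c : ℝ) (f h : V → ℝ) : Γ.energy (c • f) h = c * Γ.energy f h := by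
  simp only [energy, Finset.mul_sum, Pi.smul_apply, smul_eq_mul]
  exact Finset.sum_congr rfl fun e _ => by ring

theorem Connected.eq_of_energy_self_eq_zero (hΓ : Γ.Connected) {f : V → ℝ}
    (hf : Γ.energy f f = 0) (u v : V) : f u = f v := by
  have h := (Finset.sum_eq_zero_iff_of_nonneg fun e _ => by
    have := Γ.length_pos e
    exact div_nonneg (mul_self_nonneg _) this.le).1 hf
  have h' : ∀ e, f (Γ.src e) = f (Γ.tgt e) := fun e => by
    have h1 := h e (Finset.mem_univ e)
    rw [div_eq_zero_iff, mul_self_eq_zero, or_iff_left (Γ.length_pos e).ne', sub_eq_zero] at h1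
    exact h1
  induction hΓ.2 u v with
  | rel a b hab => obtain ⟨e, rfl, rfl⟩ := hab; exact h' e
  | refl => rfl
  | symm _ _ _ ih => exact ih.symm
  | trans _ _ _ _ _ ih1 ih2 => exact ih1.trans ih2

variable (Γ) in
/-- The Dirichlet form plus the square of the value at `o`, as a map to the dual space. -/
noncomputable def groundedForm (o : V) : (V → ℝ) →ₗ[ℝ] Module.Dual ℝ (V → ℝ) :=
  LinearMap.mk₂ ℝ (fun f h => Γ.energy f h + f o * h o)
    (fun f f' h => by simp only [energy_add_left, Pi.add_apply]; ring)
    (fun c f h => by simp only [energy_smul_left, Pi.smul_apply, smul_eq_mul]; ring)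
    (fun f h h' => by
      simp only [energy_comm f, energy_add_left, Pi.add_apply]; ring)
    (fun c f h => by simp only [energy_comm f, energy_smul_left, Pi.smul_apply, smul_eq_mul]; ring)

/-- On a connected graph the energy vanishes only on constants, so adding f(o)h(o) makes it positive
definite; in finite dimension it then represents every functional. -/
theorem Connected.exists_isGreen [Finite V] (hΓ : Γ.Connected) (o : V) : ∃ g, Γ.IsGreen o g := by
  have happ : ∀ f h, Γ.groundedForm o f h = Γ.energy f h + f o * h o := fun f h => rfl
  have hinj : Function.Injective (Γ.groundedForm o) := by
    rw [← LinearMap.ker_eq_bot, LinearMap.ker_eq_bot']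
    intro f hf
    have h1 : Γ.energy f f + f o * f o = 0 := by rw [← happ, hf]; rfl
    have h2 : 0 ≤ Γ.energy f f := Finset.sum_nonneg fun e _ =>
      div_nonneg (mul_self_nonneg _) (Γ.length_pos e).le
    have h3 := mul_self_nonneg (f o)
    have h4 : f o = 0 := mul_self_eq_zero.1 (by linarith)
    ext v
    exact (hΓ.eq_of_energy_self_eq_zero (by linarith) v o).trans h4
  have hsurj : Function.Surjective (Γ.groundedForm o) :=
    (LinearMap.injective_iff_surjective_of_finrank_eq_finrank
      Subspace.dual_finrank_eq.symm).1 hinj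
  choose g hg using fun v : V => hsurj ((LinearMap.proj v : (V → ℝ) →ₗ[ℝ] ℝ) - LinearMap.proj o)
  have h : ∀ v k, Γ.energy (g v) k + g v o * k o = k v - k o := fun v k => by
    rw [← happ, hg]; simp
  -- Testing against the constant 1 kills both the energy and the right-hand side, so the added term
  -- drops out.
  have h0 : ∀ v, g v o = 0 := fun v => by
    have := h v fun _ => 1
    simpa [energy] using this
  exact ⟨g, h0, fun v k => by have := h v k; rw [h0] at this; linarith⟩

theorem energy_eq_deleteEdge [DecidableEq E] (e : E) (f k : V → ℝ) :
    Γ.energy f k = (f (Γ.src e) - f (Γ.tgt e)) * (k (Γ.src e) - k (Γ.tgt e)) / Γ.length e +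
      (Γ.deleteEdge e).energy f k := by
  simp only [energy]
  rw [Fintype.sum_eq_add_sum_subtype_ne _ e]
  rfl

theorem IsGreen.resistance_vertex [Finite V] {o : V} {g : V → V → ℝ} (hg : Γ.IsGreen o g) (v : V) :
    Γ.resistance (.vertex o) (.vertex v) = g v v := by
  rw [resistance, hg.voltage_eq]
  simp [green, interp, edgeGreen, hg.apply_base, hg.base_apply]

/-- The Green function after an edge is added, in terms of the potential `g q` of a unit current
between its ends. -/
theorem IsGreen.of_deleteEdge [DecidableEq E] {e : E} {g : V → V → ℝ}
    (hg : (Γ.deleteEdge e).IsGreen (Γ.src e) g)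
    (hs : Γ.length e + g (Γ.tgt e) (Γ.tgt e) ≠ 0) :
    Γ.IsGreen (Γ.src e) fun u v =>
      g u v - g (Γ.tgt e) u * g (Γ.tgt e) v / (Γ.length e + g (Γ.tgt e) (Γ.tgt e)) := by
  have hL := (Γ.length_pos e).ne'
  set q := Γ.tgt e
  set s := Γ.length e + g q q with hs'
  refine ⟨fun v => by simp [hg.apply_base], fun v k => ?_⟩
  -- Sherman–Morrison: the restored edge adds a rank one term to the form, and `g q` represents its
  -- functional, so the inverse changes by a multiple of `g q`.
  have hfun : (fun w => g v w - g q v * g q w / s) = g v + (-(g q v / s)) • g q := by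
    ext w; simp only [Pi.add_apply, Pi.smul_apply, smul_eq_mul]; ring
  rw [energy_eq_deleteEdge e, hfun, energy_add_left, energy_smul_left, hg.energy_eq, hg.energy_eq]
  simp only [hg.apply_base, hg.symm v (Γ.tgt e)]
  change (0 - g q v * 0 / s - (g q v - g q v * g q q / s)) * (k (Γ.src e) - k q) / Γ.length e +
    _ = _
  have : Γ.length e = s - g q q := by rw [hs']; ring
  rw [this] at hL ⊢
  field_simp
  ring

/-- With the ground at p, j_p(x,q) = g(q,x) is affine on each edge, and j_x(p,q) = g(x,x) - g(q,x)
is affine plus `diagExcess`. -/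
theorem IsGreen.integralA_eq [Finite V] {p : V} {g : V → V → ℝ} (hg : Γ.IsGreen p g) (q : V) :
    Γ.integralA (.vertex p) (.vertex q) =
      ∑ e, ((g q (Γ.tgt e) - g q (Γ.src e)) / Γ.length e) ^ 2 *
        (Γ.length e * (g (Γ.src e) (Γ.src e) - g q (Γ.src e) +
          (g (Γ.tgt e) (Γ.tgt e) - g q (Γ.tgt e))) / 2 +
          Γ.edgeDensity g e * Γ.length e ^ 3 / 6) := by
  have h1 : ∀ x : Γ.Point, Γ.voltage (.vertex p) x (.vertex q) = interp (g q) x := fun x => by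
    rw [hg.voltage_eq, hg.green_comm x, hg.green_comm x]
    have h0 : interp (g p) x = 0 := by cases x <;> simp [interp, hg.base_apply]
    have h2 : ∀ v, interp (fun u => interp (g u) x) (.vertex v : Γ.Point) = interp (g v) x :=
      fun v => rfl
    simp [green, edgeGreen_vertex_left, h2, h0]
    simp [interp, hg.base_apply]
  have h2 : ∀ x : Γ.Point, Γ.voltage x (.vertex p) (.vertex q) =
      interp (fun v => g v v - g q v) x + diagExcess g x := fun x => by
    rw [hg.voltage_eq, hg.green_self, hg.green_comm x]
    have h0 : interp (g p) x = 0 := by cases x <;> simp [interp, hg.base_apply]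
    have h2 : ∀ v, interp (fun u => interp (g u) x) (.vertex v : Γ.Point) = interp (g v) x :=
      fun v => rfl
    have h3 : interp (fun v => g v v - g q v) x = interp (fun v => g v v) x - interp (g q) x := by
      cases x <;> simp only [interp]; ring
    simp only [green, edgeGreen_vertex_left, h2, h0, h3]
    simp [interp, hg.base_apply]
    ring
  refine Finset.sum_congr rfl fun e _ => ?_
  have hL := Γ.length_pos e
  have h3 : ∫ t in (0 : ℝ)..Γ.length e, Γ.voltage (Γ.pt e t) (.vertex p) (.vertex q) *
      deriv (fun s => Γ.voltage (.vertex p) (Γ.pt e s) (.vertex q)) t ^ 2 =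
      ∫ t in (0 : ℝ)..Γ.length e, ((g q (Γ.tgt e) - g q (Γ.src e)) / Γ.length e) ^ 2 *
        ((g (Γ.src e) (Γ.src e) - g q (Γ.src e) +
          ((g (Γ.tgt e) (Γ.tgt e) - g q (Γ.tgt e)) - (g (Γ.src e) (Γ.src e) - g q (Γ.src e))) *
            (t / Γ.length e)) + Γ.edgeDensity g e * (t * (Γ.length e - t))) := by
    -- The end points are discarded: `pt` is clamped there and the two-sided derivative may fail to
    -- exist.
    rw [intervalIntegral.integral_of_le hL.le, intervalIntegral.integral_of_le hL.le,
      integral_Ioc_eq_integral_Ioo, integral_Ioc_eq_integral_Ioo]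
    refine setIntegral_congr_fun measurableSet_Ioo fun t ht => ?_
    have hd : HasDerivAt (fun s => Γ.voltage (.vertex p) (Γ.pt e s) (.vertex q))
        ((g q (Γ.tgt e) - g q (Γ.src e)) / Γ.length e) t := by
      have h4 : HasDerivAt (fun s => g q (Γ.src e) + (g q (Γ.tgt e) - g q (Γ.src e)) *
          (s / Γ.length e)) ((g q (Γ.tgt e) - g q (Γ.src e)) / Γ.length e) t := by
        convert! (((hasDerivAt_id t).div_const (Γ.length e)).const_mul
          (g q (Γ.tgt e) - g q (Γ.src e))).const_add (g q (Γ.src e)) using 1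
        ring
      refine h4.congr_of_eventuallyEq ?_
      filter_upwards [isOpen_Ioo.mem_nhds ht] with s hs
      rw [h1, interp_pt_of_mem _ (Ioo_subset_Icc_self hs)]
    simp only [hd.deriv, h2, interp_pt_of_mem _ (Ioo_subset_Icc_self ht),
      diagExcess_pt_of_mem _ (Ioo_subset_Icc_self ht)]
    ring
  rw [h3, intervalIntegral.integral_const_mul, intervalIntegral.integral_add
    (Continuous.intervalIntegrable (by fun_prop) _ _)
    (Continuous.intervalIntegrable (by fun_prop) _ _), integral_affine_div hL,
    integral_mul_sub_self]

end MetrizedGraph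

/-! ### The deletion formula -/

open MetrizedGraph in
theorem mainTheorem3 {V E : Type*} [Finite V] [Fintype E] [DecidableEq E]
    (Γ : MetrizedGraph V E) (e : E) (hconn : (Γ.deleteEdge e).Connected)
    (R : ℝ)
    (hR : R = (Γ.deleteEdge e).resistance (.vertex (Γ.src e)) (.vertex (Γ.tgt e))) :
    Γ.tau = (Γ.deleteEdge e).tau + Γ.length e / 12 - R / 6 +
      (Γ.deleteEdge e).integralA (.vertex (Γ.src e)) (.vertex (Γ.tgt e)) /
        (Γ.length e + R) := by
  obtain ⟨g, hg⟩ := hconn.exists_isGreen (Γ.src e)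
  have hL := Γ.length_pos e
  rw [hg.resistance_vertex] at hR
  -- R is the energy of its own potential `g q`.
  have hRnn : 0 ≤ R := by
    have h := hg.energy_eq (Γ.tgt e) (g (Γ.tgt e))
    rw [hg.apply_base, sub_zero, ← hR] at h
    rw [← h]
    exact Finset.sum_nonneg fun e' _ => div_nonneg (mul_self_nonneg _) (Γ.length_pos e').le
  have hs : Γ.length e + R ≠ 0 := by positivity
  have hG := IsGreen.of_deleteEdge hg (by rwa [← hR])
  rw [hG.tau_eq, hg.tau_eq]
  set p := Γ.src e
  set q := Γ.tgt e with hq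
  set s := Γ.length e + R with hs'
  -- With h = g(q,·), the reproducing property evaluates the three energies left by the expansion:
  -- R², R³ and R².
  have hg1 := hg.energy_eq q fun v => g q v ^ 2
  have hg2 := hg.energy_eq q fun v => g q v ^ 3
  have hg3 := hg.energy_eq q fun v => g q v * g v v
  simp only [hg.apply_base, ← hR] at hg1 hg2 hg3
  -- Contribution of the old edges to τ(Γ), expanded in 1/s. The update raises each density by
  -- (Δh)²/(s L²), whose cross term with the old density is the `edgeDensity` part of A/s. The
  -- identity holds edge by edge, as a rational identity in the end values.
  have htot : 1 / 2 * (1 / 2 * (Γ.deleteEdge e).energy (fun u => g u u - g q u * g q u / s)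
        (fun u => g u u - g q u * g q u / s) + 1 / 6 * ∑ e' : {e' // e' ≠ e},
          Γ.edgeDensity (fun u v => g u v - g q u * g q v / s) e' ^ 2 * Γ.length e' ^ 3) =
      1 / 2 * (Γ.deleteEdge e).canonicalConstant g +
      (∑ e', ((g q ((Γ.deleteEdge e).tgt e') - g q ((Γ.deleteEdge e).src e')) /
          (Γ.deleteEdge e).length e') ^ 2 *
        ((Γ.deleteEdge e).length e' * (g ((Γ.deleteEdge e).src e') ((Γ.deleteEdge e).src e') -
          g q ((Γ.deleteEdge e).src e') + (g ((Γ.deleteEdge e).tgt e') ((Γ.deleteEdge e).tgt e') -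
          g q ((Γ.deleteEdge e).tgt e'))) / 2 +
          (Γ.deleteEdge e).edgeDensity g e' * (Γ.deleteEdge e).length e' ^ 3 / 6)) / s +
      (1 / (2 * s) * (Γ.deleteEdge e).energy (g q) (fun v => g q v ^ 2) -
        1 / s * (Γ.deleteEdge e).energy (g q) (fun v => g q v * g v v) +
        1 / (3 * s ^ 2) * (Γ.deleteEdge e).energy (g q) (fun v => g q v ^ 3)) := by
    simp only [energy, canonicalConstant, edgeDensity, Finset.mul_sum, Finset.sum_div,
      ← Finset.sum_add_distrib, ← Finset.sum_sub_distrib]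
    refine Finset.sum_congr rfl fun e' _ => ?_
    have hL' := (Γ.length_pos e').ne'
    simp only [deleteEdge]
    generalize g (Γ.src e') (Γ.src e') = Da
    generalize g (Γ.tgt e') (Γ.tgt e') = Db
    generalize g (Γ.src e') (Γ.tgt e') = gab
    generalize g q (Γ.src e') = ha
    generalize g q (Γ.tgt e') = hb
    generalize Γ.length e' = l at *
    field_simp
    ring
  rw [hg1, hg2, hg3, ← hg.integralA_eq] at htot
  -- The last summand is the share of the restored edge: D is 0 at p and R - R²/s at q, and the
  -- latter is also the resistance across the edge in Γ.
  have hsplit : 1 / 2 * Γ.canonicalConstant (fun u v => g u v - g q u * g q v / s) =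
      1 / 2 * (1 / 2 * (Γ.deleteEdge e).energy (fun u => g u u - g q u * g q u / s)
        (fun u => g u u - g q u * g q u / s) + 1 / 6 * ∑ e' : {e' // e' ≠ e},
          Γ.edgeDensity (fun u v => g u v - g q u * g q v / s) e' ^ 2 * Γ.length e' ^ 3) +
      (1 / 4 * (R - R * R / s) ^ 2 / Γ.length e +
        1 / 12 * (1 / Γ.length e - (R - R * R / s) / Γ.length e ^ 2) ^ 2 * Γ.length e ^ 3) := by
    simp only [canonicalConstant, energy_eq_deleteEdge e, Fintype.sum_eq_add_sum_subtype_ne _ e]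
    have he : Γ.edgeDensity (fun u v => g u v - g q u * g q v / s) e =
        1 / Γ.length e - (R - R * R / s) / Γ.length e ^ 2 := by
      simp only [edgeDensity]
      change 1 / Γ.length e - (g p p - g q p * g q p / s + (g q q - g q q * g q q / s) -
        2 * (g p q - g q p * g q q / s)) / Γ.length e ^ 2 = _
      rw [hg.apply_base, hg.apply_base, hg.base_apply, ← hR]
      ring
    rw [he]
    change 1 / 2 * (1 / 2 * ((g p p - g q p * g q p / s - (g q q - g q q * g q q / s)) *
      (g p p - g q p * g q p / s - (g q q - g q q * g q q / s)) / Γ.length e + _) + _) = _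
    rw [hg.apply_base, hg.apply_base, ← hR]
    ring
  rw [← hR, hsplit, htot]
  generalize (Γ.deleteEdge e).integralA _ _ = A
  generalize (Γ.deleteEdge e).canonicalConstant g = c
  -- What remains is L³ - 3LR² - 2R³ = (L - 2R)s², up to the factor 12s².
  have hLs : Γ.length e = s - R := by rw [hs']; ring
  rw [hLs] at hL ⊢
  have hL' := hL.ne'
  field_simp
  ring
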